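/- **Theorem 3.2.** Let $\mathfrak A$ be a real normed division algebra (finite-dimensional, unital, with an inner product satisfying $(xy,xy)=(x,x)(y,y)$), let $\beta=\dim_{\mathbb R}\mathfrak A$, let $n\ge m\ge 1$ be integers, and assume that $\mathfrak A$ is associative (so $\mathfrak A$ is $\mathbb R$, $\mathbb C$ or $\mathbb H$) or that $m\le 2$ (so that the octonions are allowed for $m\le 2$ only). Let $\nu\in\mathbb R$ and $\kappa=(k_1,\dots,k_m),\ \tau=(t_1,\dots,t_m)\in\mathbb R^m$. Notation. $\mathbf R^*$ is the conjugate transpose. $(d\mathbf R)$ is Lebesgue measure on $\mathfrak A^{n\times m}$, and $(d\mathbf B)$ is Lebesgue measure on the Hermitian $m\times m$ matrices (the product of the Lebesgue measures of the diagonal entries and of the entries on one side of the diagonal). $\mathbf A>0$ means that $\mathbf A$ is Hermitian positive definite, and $|\mathbf A|>0$ is then its determinant, that is, $|\mathbf A|^{\beta}$ is the determinant of $v\mapsto \mathbf Av$ as a real-linear map on $\mathfrak A^m$. With $\mathbf A_i$ the leading principal $i\times i$ block, $$q_\kappa(\mathbf A)=|\mathbf A_m|^{k_m}\prod_{i=1}^{m-1}|\mathbf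 A_i|^{k_i-k_{i+1}} .$$ Let $$\Gamma_m^\beta[a]=\int_{\mathbf A>0}e^{-\operatorname{Re}\operatorname{tr}\mathbf A}\,|\mathbf A|^{a-(m-1)\beta/2-1}(d\mathbf A),$$ $$\mathcal B_m^\beta[a,\kappa;b,\tau]=\int_{0<\mathbf S<\mathbf I_m}|\mathbf S|^{a-(m-1)\beta/2-1}q_\kappa(\mathbf S)\,|\mathbf I_m-\mathbf S|^{b-(m-1)\beta/2-1}q_\tau(\mathbf I_m-\mathbf S)\,(d\mathbf S),$$ and let $\mathcal B_m^\beta[a,-\kappa;b,-\tau]$ be the same integral with $q_\kappa(\mathbf S^{-1})$ and $q_\tau((\mathbf I_m-\mathbf S)^{-1})$ in place of $q_\kappa(\mathbf S)$ and $q_\tau(\mathbf I_m-\mathbf S)$. Let $\mathbf R$ be a random $n\times m$ matrix over $\mathfrak A$ and $\mathbf B=\mathbf R^*\mathbf R$. 1. Suppose that $\mathbf R$ has the standardised matricvariate Pearson type II-Riesz distribution of type I, that is, the density $$\frac{\Gamma_m^\beta[n\beta/2]}{\pi^{mn\beta/2}\,\mathcal B_m^\beta[\nu\beta/2,\kappa;n\beta/2,\tau]}\,|\mathbf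 I_m-\mathbf R^*\mathbf R|^{(\nu-m+1)\beta/2-1}\,q_\kappa(\mathbf I_m-\mathbf R^*\mathbf R)\,q_\tau(\mathbf R^*\mathbf R)$$ with respect to $(d\mathbf R)$ on $\{0<\mathbf R^*\mathbf R<\mathbf I_m\}$. Then $\mathbf B$ has the matricvariate c-beta-Riesz type I distribution, that is, the density $$\frac{|\mathbf B|^{(n-m+1)\beta/2-1}}{\mathcal B_m^\beta[\nu\beta/2,\kappa;n\beta/2,\tau]}\,|\mathbf I_m-\mathbf B|^{(\nu-m+1)\beta/2-1}\,q_\kappa(\mathbf I_m-\mathbf B)\,q_\tau(\mathbf B)$$ with respect to $(d\mathbf B)$ on $\{0<\mathbf B<\mathbf I_m\}$. 2. Suppose that $\mathbf R$ has the standardised matricvariate Pearson type II-Riesz distribution of type II, that is, the density $$\frac{\Gamma_m^\beta[n\beta/2]}{\pi^{mn\beta/2}\,\mathcal B_m^\beta[\nu\beta/2,-\kappa;n\beta/2,-\tau]}\,|\mathbf I_m-\mathbf R^*\mathbf R|^{(\nu-m+1)\beta/2-1}\,q_\kappa\big((\mathbf I_m-\mathbf R^*\mathbf R)^{-1}\big)\,q_\tau\big((\mathbf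 R^*\mathbf R)^{-1}\big)$$ with respect to $(d\mathbf R)$ on $\{0<\mathbf R^*\mathbf R<\mathbf I_m\}$. Then $\mathbf B$ has the matricvariate k-beta-Riesz type I distribution, that is, the density $$\frac{|\mathbf B|^{(n-m+1)\beta/2-1}}{\mathcal B_m^\beta[\nu\beta/2,-\kappa;n\beta/2,-\tau]}\,|\mathbf I_m-\mathbf B|^{(\nu-m+1)\beta/2-1}\,q_\kappa\big((\mathbf I_m-\mathbf B)^{-1}\big)\,q_\tau(\mathbf B^{-1})$$ with respect to $(d\mathbf B)$ on $\{0<\mathbf B<\mathbf I_m\}$. -/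

import Mathlib

open MeasureTheory ProbabilityTheory

namespace NormedDivision

/-- A real normed division algebra: a finite-dimensional (see the binder
`[FiniteDimensional ℝ 𝔄]` wherever this class is used), nonzero, unital, not necessarily
associative real algebra `𝔄` with an inner product such that `(xy, xy) = (x, x) (y, y)`.
Addition, scalars and the inner product are those of the inner product space `𝔄`. -/
class RealNormedDivisionAlgebra (𝔄 : Type*) [NormedAddCommGroup 𝔄] [InnerProductSpace ℝ 𝔄]
    [Mul 𝔄] [One 𝔄] : Prop where
  one_ne_zero : (1 : 𝔄) ≠ 0
  one_mul : ∀ x : 𝔄, 1 * x = x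
  mul_one : ∀ x : 𝔄, x * 1 = x
  add_mul : ∀ x y z : 𝔄, (x + y) * z = x * z + y * z
  mul_add : ∀ x y z : 𝔄, x * (y + z) = x * y + x * z
  smul_mul : ∀ (c : ℝ) (x y : 𝔄), (c • x) * y = c • (x * y)
  mul_smul : ∀ (c : ℝ) (x y : 𝔄), x * (c • y) = c • (x * y)
  inner_mul_self : ∀ x y : 𝔄, inner ℝ (x * y) (x * y) = inner ℝ x x * inner ℝ y y

section Algebra

variable {𝔄 : Type*} [NormedAddCommGroup 𝔄] [InnerProductSpace ℝ 𝔄] [Mul 𝔄] [One 𝔄]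

variable (𝔄) in
/-- `β`, the real dimension of the algebra (1, 2, 4 or 8). -/
noncomputable def algDim : ℝ := (Module.finrank ℝ 𝔄 : ℝ)

/-- The real part of an element of `𝔄`. -/
noncomputable def rePart (x : 𝔄) : ℝ := inner ℝ (1 : 𝔄) x

/-- Conjugation in `𝔄`: it fixes the real line and is `-1` on its orthogonal complement. -/
noncomputable def conj (x : 𝔄) : 𝔄 := (2 * rePart x) • (1 : 𝔄) - x

/-- `R* R`, where `R*` is the conjugate transpose of the matrix `R`. -/
noncomputable def starMulSelf {n m : ℕ} (R : Matrix (Fin n) (Fin m) 𝔄) :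
    Matrix (Fin m) (Fin m) 𝔄 :=
  Matrix.of fun i j => ∑ k, conj (R k i) * R k j

/-- `A = A*`. -/
def IsHermitian {m : ℕ} (A : Matrix (Fin m) (Fin m) 𝔄) : Prop :=
  ∀ i j, A j i = conj (A i j)

variable [RealNormedDivisionAlgebra 𝔄]

/-- The real-linear map `v ↦ A v` on the space `𝔄 ^ m` of column vectors. -/
def leftMul {m : ℕ} (A : Matrix (Fin m) (Fin m) 𝔄) : (Fin m → 𝔄) →ₗ[ℝ] (Fin m → 𝔄) where
  toFun v := fun i => ∑ j, A i j * v j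
  map_add' v w := by
    funext i
    simp [RealNormedDivisionAlgebra.mul_add, Finset.sum_add_distrib]
  map_smul' c v := by
    funext i
    simp [RealNormedDivisionAlgebra.mul_smul, Finset.smul_sum]

/-- `A` is positive definite: it is Hermitian and `Re (v* (A v)) > 0` for all `v ≠ 0`. The real
part of `x* y` is the inner product of `x` and `y`. -/
def IsPosDef {m : ℕ} (A : Matrix (Fin m) (Fin m) 𝔄) : Prop :=
  IsHermitian A ∧ ∀ v : Fin m → 𝔄, v ≠ 0 → 0 < ∑ i, inner ℝ (v i) (leftMul A v i)

/-- The determinant `|A|` of a positive definite matrix: the positive number whose `β`-th power is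
the determinant of `v ↦ A v` as a real-linear map on the `β m`-dimensional space `𝔄 ^ m`. Over the
reals and the complex numbers it is the usual determinant, over the quaternions the Moore
determinant, i.e. in the associative case the product of the `m` eigenvalues; for a 2 × 2 matrix
with diagonal `a, d` and off-diagonal entry `x` it is `a d - ‖x‖ ^ 2` for all four algebras.
(It is only used for positive definite matrices.) -/
noncomputable def detPos {m : ℕ} (A : Matrix (Fin m) (Fin m) 𝔄) : ℝ :=
  (LinearMap.det (leftMul A)) ^ (1 / algDim 𝔄)

/-- The inverse matrix: its `j`-th column is the solution `v` of `A v = e_j`. (The zero matrix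
if `v ↦ A v` is not invertible.) -/
noncomputable def matInv {m : ℕ} (A : Matrix (Fin m) (Fin m) 𝔄) : Matrix (Fin m) (Fin m) 𝔄 :=
  Matrix.of fun i j => (Ring.inverse (leftMul A : Module.End ℝ (Fin m → 𝔄))) (Pi.single j 1) i

/-- The leading principal `p × p` block of `A`. -/
def leadingBlock {m : ℕ} (A : Matrix (Fin m) (Fin m) 𝔄) (p : ℕ) (hp : p ≤ m) :
    Matrix (Fin p) (Fin p) 𝔄 :=
  A.submatrix (Fin.castLE hp) (Fin.castLE hp)

/-- The highest weight vector (generalised power)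
`q_κ(A) = |A_m| ^ k_m * ∏_{i = 1}^{m - 1} |A_i| ^ (k_i - k_{i+1})`, where `A_i` is the leading
principal `i × i` block. In the code the indices start at `0`, and `k_{m+1}` is read as `0`. -/
noncomputable def highestWeight {m : ℕ} (κ : Fin m → ℝ) (A : Matrix (Fin m) (Fin m) 𝔄) : ℝ :=
  ∏ i : Fin m, detPos (leadingBlock A (i + 1) i.isLt) ^
    (κ i - if h : (i : ℕ) + 1 < m then κ ⟨i + 1, h⟩ else 0)

/-- The real part of the trace. -/
noncomputable def reTrace {m : ℕ} (A : Matrix (Fin m) (Fin m) 𝔄) : ℝ :=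
  ∑ i, rePart (A i i)

end Algebra

section Measures

/-- The product σ-algebra on matrices. -/
instance instMeasurableSpaceMatrix {ι κ α : Type*} [MeasurableSpace α] :
    MeasurableSpace (Matrix ι κ α) :=
  inferInstanceAs (MeasurableSpace (ι → κ → α))

variable (𝔄 : Type*) [NormedAddCommGroup 𝔄] [InnerProductSpace ℝ 𝔄] [FiniteDimensional ℝ 𝔄]
  [MeasurableSpace 𝔄] [BorelSpace 𝔄]

/-- `(dX)`: Lebesgue measure on the `n × m` matrices over `𝔄`, i.e. the product of the Lebesgue
measures (with respect to orthonormal coordinates in `𝔄`) of all the entries. -/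
noncomputable def lebesgueMat (n m : ℕ) : Measure (Matrix (Fin n) (Fin m) 𝔄) :=
  Measure.pi fun _ : Fin n => Measure.pi fun _ : Fin m => (volume : Measure 𝔄)

variable {𝔄} [Mul 𝔄] [One 𝔄]

/-- The Hermitian matrix with given (real) diagonal entries and given entries above the
diagonal. -/
noncomputable def hermOfCoords {m : ℕ}
    (c : (Fin m → ℝ) × ({p : Fin m × Fin m // p.1 < p.2} → 𝔄)) : Matrix (Fin m) (Fin m) 𝔄 :=
  Matrix.of fun i j =>
    if hij : i < j then c.2 ⟨(i, j), hij⟩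
    else if hji : j < i then conj (c.2 ⟨(j, i), hji⟩)
    else c.1 i • (1 : 𝔄)

variable (𝔄)

/-- `(dS)`: Lebesgue measure on the real vector space of Hermitian `m × m` matrices, i.e. the
product of the Lebesgue measures of the diagonal entries (in `ℝ`) and of the entries on one side of
the diagonal (in `𝔄`); as a measure on all `m × m` matrices, it is carried by the Hermitian
ones. -/
noncomputable def lebesgueHerm (m : ℕ) : Measure (Matrix (Fin m) (Fin m) 𝔄) :=
  Measure.map hermOfCoords
    ((volume : Measure (Fin m → ℝ)).prod
      (Measure.pi fun _ : {p : Fin m × Fin m // p.1 < p.2} => (volume : Measure 𝔄)))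

variable [RealNormedDivisionAlgebra 𝔄]

/-- The matrices `S` with `0 < S < I`. -/
def unitCone (m : ℕ) : Set (Matrix (Fin m) (Fin m) 𝔄) :=
  {S | IsPosDef S ∧ IsPosDef (1 - S)}

/-- The multivariate gamma function `Γ_m[a]`: the integral of
`etr(-A) |A| ^ (a - (m - 1) β / 2 - 1)` over the positive definite matrices. -/
noncomputable def multiGamma (m : ℕ) (a : ℝ) : ℝ :=
  ∫ A in {A : Matrix (Fin m) (Fin m) 𝔄 | IsPosDef A},
    Real.exp (-reTrace A) * detPos A ^ (a - ((m : ℝ) - 1) * algDim 𝔄 / 2 - 1) ∂(lebesgueHerm 𝔄 m)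

/-- The generalised c-beta function `B_m[a, κ; b, τ]`. -/
noncomputable def cBeta {m : ℕ} (a : ℝ) (κ : Fin m → ℝ) (b : ℝ) (τ : Fin m → ℝ) : ℝ :=
  ∫ S in unitCone 𝔄 m,
    detPos S ^ (a - ((m : ℝ) - 1) * algDim 𝔄 / 2 - 1) * highestWeight κ S *
      detPos (1 - S) ^ (b - ((m : ℝ) - 1) * algDim 𝔄 / 2 - 1) * highestWeight τ (1 - S)
    ∂(lebesgueHerm 𝔄 m)

/-- The generalised k-beta function `B_m[a, -κ; b, -τ]` (as a function of `κ` and `τ`). -/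
noncomputable def kBeta {m : ℕ} (a : ℝ) (κ : Fin m → ℝ) (b : ℝ) (τ : Fin m → ℝ) : ℝ :=
  ∫ S in unitCone 𝔄 m,
    detPos S ^ (a - ((m : ℝ) - 1) * algDim 𝔄 / 2 - 1) * highestWeight κ (matInv S) *
      detPos (1 - S) ^ (b - ((m : ℝ) - 1) * algDim 𝔄 / 2 - 1) * highestWeight τ (matInv (1 - S))
    ∂(lebesgueHerm 𝔄 m)

/-- The standardised matricvariate Pearson type II-Riesz distribution of type I, given by its
density with respect to `(dR)`. The density lives on the matrices `R` of rank `m` (that is, `R* R`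
is positive definite) such that `I - R* R` is positive definite. -/
noncomputable def pearsonRieszI (n : ℕ) {m : ℕ} (ν : ℝ) (κ τ : Fin m → ℝ) :
    Measure (Matrix (Fin n) (Fin m) 𝔄) :=
  (lebesgueMat 𝔄 n m).withDensity <| (starMulSelf ⁻¹' unitCone 𝔄 m).indicator fun R =>
    ENNReal.ofReal
      (multiGamma 𝔄 m (n * algDim 𝔄 / 2) /
          (Real.pi ^ (m * n * algDim 𝔄 / 2) * cBeta 𝔄 (ν * algDim 𝔄 / 2) κ (n * algDim 𝔄 / 2) τ) *
        detPos (1 - starMulSelf R) ^ ((ν - m + 1) * algDim 𝔄 / 2 - 1) *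
        highestWeight κ (1 - starMulSelf R) * highestWeight τ (starMulSelf R))

/-- The standardised matricvariate Pearson type II-Riesz distribution of type II, given by its
density with respect to `(dR)`, with the same support as type I. -/
noncomputable def pearsonRieszII (n : ℕ) {m : ℕ} (ν : ℝ) (κ τ : Fin m → ℝ) :
    Measure (Matrix (Fin n) (Fin m) 𝔄) :=
  (lebesgueMat 𝔄 n m).withDensity <| (starMulSelf ⁻¹' unitCone 𝔄 m).indicator fun R =>
    ENNReal.ofReal
      (multiGamma 𝔄 m (n * algDim 𝔄 / 2) /
          (Real.pi ^ (m * n * algDim 𝔄 / 2) * kBeta 𝔄 (ν * algDim 𝔄 / 2) κ (n * algDim 𝔄 / 2) τ) *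
        detPos (1 - starMulSelf R) ^ ((ν - m + 1) * algDim 𝔄 / 2 - 1) *
        highestWeight κ (matInv (1 - starMulSelf R)) * highestWeight τ (matInv (starMulSelf R)))

/-- The matricvariate c-beta-Riesz type I distribution, given by its density with respect to `(dB)`
on `0 < B < I`. -/
noncomputable def cBetaRieszI (n : ℕ) {m : ℕ} (ν : ℝ) (κ τ : Fin m → ℝ) :
    Measure (Matrix (Fin m) (Fin m) 𝔄) :=
  (lebesgueHerm 𝔄 m).withDensity <| (unitCone 𝔄 m).indicator fun B =>
    ENNReal.ofReal
      (detPos B ^ (((n : ℝ) - m + 1) * algDim 𝔄 / 2 - 1) /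
          cBeta 𝔄 (ν * algDim 𝔄 / 2) κ (n * algDim 𝔄 / 2) τ *
        detPos (1 - B) ^ ((ν - m + 1) * algDim 𝔄 / 2 - 1) *
        highestWeight κ (1 - B) * highestWeight τ B)

/-- The matricvariate k-beta-Riesz type I distribution, given by its density with respect to `(dB)`
on `0 < B < I`. -/
noncomputable def kBetaRieszI (n : ℕ) {m : ℕ} (ν : ℝ) (κ τ : Fin m → ℝ) :
    Measure (Matrix (Fin m) (Fin m) 𝔄) :=
  (lebesgueHerm 𝔄 m).withDensity <| (unitCone 𝔄 m).indicator fun B =>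
    ENNReal.ofReal
      (detPos B ^ (((n : ℝ) - m + 1) * algDim 𝔄 / 2 - 1) /
          kBeta 𝔄 (ν * algDim 𝔄 / 2) κ (n * algDim 𝔄 / 2) τ *
        detPos (1 - B) ^ ((ν - m + 1) * algDim 𝔄 / 2 - 1) *
        highestWeight κ (matInv (1 - B)) * highestWeight τ (matInv B))

end Measures

end NormedDivision

open NormedDivision

/-! Both densities depend on `R` only through `R* R`, so everything rests on the image of Lebesgue
measure under `R ↦ R* R`: it is `π^(mnβ/2) / Γ_m[nβ/2]` times `|B|^((n-m+1)β/2-1) (dB)` on the cone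
`B > 0`. The generalised powers, the beta constants and their convergence play no role beyond
measurability of the density.

Up to a constant, this image is found by induction on the number of columns
(`exists_lintegral_starMulSelf`). Fix the first `m` columns `R`, with `A = R* R > 0`, and append a
column `y`. The new Gram matrix is `A` bordered by `w = R* y` and `a = ‖y‖²`. Split `y` along the
kernel of `y ↦ R* y` and its orthogonal complement (`lintegral_linear_norm_sq`). The complement is
parametrised by `w`, with Jacobian `|A|^(-β/2)` and squared norm `w* A⁻¹ w`. Polar coordinates on
the kernel, of real dimension `(n-m)β`, give the density `(a - w* A⁻¹ w)^((n-m)β/2-1)`. Since the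
bordered determinant is `|A| (a - w* A⁻¹ w)`, the powers recombine into the required one. The
constant is then read off by integrating `exp(-Re tr R* R)`
(`multiGamma_pos_and_lintegral_starMulSelf`).

Associativity enters in two places: `R* (R u) = (R* R) u` (`starMul_mul`) and the fact that `w* A⁻¹
w` acts as a real scalar (`rowMap_inverse_colMap`). If the block `A` has size at most 1, the
identity `conj x * (x * z) = ‖x‖² z` of composition algebras replaces it, which accounts for the
bound `m ≤ 2` on the full matrix. -/

namespace NormedDivision

open Set Module

/-! ### Polar coordinates in terms of the squared norm -/

section Radial

/-- The constant in the integration formula `lintegral_comp_norm_sq`: half the area of the unit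
sphere of a `d`-dimensional Euclidean space. -/
noncomputable def radialConst (d : ℕ) : ENNReal :=
  (volume : Measure (EuclideanSpace ℝ (Fin d))).toSphere univ * ENNReal.ofReal (1 / 2)

/-- Substitution `t = r²`, using `r^(d-1) = ½ · 2r · (r²)^(d/2-1)`. -/
lemma lintegral_pow_mul_comp_sq (d : ℕ) (hd : 0 < d) (g : ℝ → ENNReal) :
    ∫⁻ r in Ioi (0 : ℝ), ENNReal.ofReal (r ^ (d - 1)) * g (r ^ 2) =
      ENNReal.ofReal (1 / 2) *
        ∫⁻ t in Ioi (0 : ℝ), ENNReal.ofReal (t ^ ((d : ℝ) / 2 - 1)) * g t := by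
  have himage : (fun r : ℝ => r ^ 2) '' Ioi 0 = Ioi 0 := by
    ext t
    constructor
    · rintro ⟨r, hr, rfl⟩
      exact pow_pos (mem_Ioi.1 hr) 2
    · intro ht
      exact ⟨Real.sqrt t, Real.sqrt_pos.2 ht, Real.sq_sqrt (le_of_lt ht)⟩
  have hinj : InjOn (fun r : ℝ => r ^ 2) (Ioi 0) := by
    intro x hx y hy h
    exact (pow_left_inj₀ (le_of_lt hx) (le_of_lt hy) two_ne_zero).1 h
  have h := lintegral_image_eq_lintegral_abs_deriv_mul measurableSet_Ioi
    (fun r _ => ((hasDerivAt_pow 2 r).hasDerivWithinAt (s := Ioi (0 : ℝ)))) hinj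
    (fun t => ENNReal.ofReal (t ^ ((d : ℝ) / 2 - 1)) * g t)
  rw [himage] at h
  rw [h, ← lintegral_const_mul' _ _ ENNReal.ofReal_ne_top]
  refine setLIntegral_congr_fun measurableSet_Ioi fun r hr => ?_
  have hr : 0 < r := hr
  have hpow : r ^ (d - 1) = 1 / 2 * (|(2 : ℝ) * r| * (r ^ 2) ^ ((d : ℝ) / 2 - 1)) := by
    rw [abs_of_pos (by positivity), ← Real.rpow_natCast r 2, ← Real.rpow_mul hr.le,
      ← Real.rpow_natCast r (d - 1), Nat.cast_sub hd]
    have : (((2 : ℕ) : ℝ) * ((d : ℝ) / 2 - 1)) = ((d : ℝ) - (1 : ℕ)) - 1 := by push_cast; ring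
    rw [this, Real.rpow_sub_one hr.ne']
    field_simp
  simp only [Nat.cast_ofNat, Nat.add_one_sub_one, pow_one]
  rw [hpow, ENNReal.ofReal_mul (by norm_num), ENNReal.ofReal_mul (abs_nonneg _)]
  simp only [mul_assoc]

lemma lintegral_comp_norm_sq_euclidean {d : ℕ} (hd : 0 < d) {g : ℝ → ENNReal}
    (hg : Measurable g) :
    ∫⁻ v : EuclideanSpace ℝ (Fin d), g (‖v‖ ^ 2) =
      radialConst d * ∫⁻ t in Ioi (0 : ℝ), ENNReal.ofReal (t ^ ((d : ℝ) / 2 - 1)) * g t := by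
  set μ : Measure (EuclideanSpace ℝ (Fin d)) := volume
  have : Nonempty (Fin d) := ⟨⟨0, hd⟩⟩
  have h1 : ∫⁻ v, g (‖v‖ ^ 2) ∂μ =
      ∫⁻ p : Metric.sphere (0 : EuclideanSpace ℝ (Fin d)) 1 × Ioi (0 : ℝ),
        g ((p.2 : ℝ) ^ 2) ∂(μ.toSphere.prod (.volumeIoiPow (d - 1))) := by
    have h := μ.measurePreserving_homeomorphUnitSphereProd.lintegral_comp_emb
      (Homeomorph.measurableEmbedding _) (fun p => g ((p.2 : ℝ) ^ 2))
    simp only [homeomorphUnitSphereProd_apply_snd_coe, finrank_euclideanSpace_fin] at h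
    rw [← h, lintegral_subtype_comap (measurableSet_singleton _).compl
      (fun x : EuclideanSpace ℝ (Fin d) => g (‖x‖ ^ 2)), restrict_compl_singleton]
  rw [h1, lintegral_prod _ (by fun_prop)]
  simp only [lintegral_const]
  rw [Measure.volumeIoiPow, lintegral_withDensity_eq_lintegral_mul _ (by fun_prop) (by fun_prop)]
  simp only [Pi.mul_apply]
  rw [lintegral_subtype_comap measurableSet_Ioi
    (fun r : ℝ => ENNReal.ofReal (r ^ (d - 1)) * g (r ^ 2)), lintegral_pow_mul_comp_sq d hd,
    radialConst]
  ring

variable {V : Type*} [NormedAddCommGroup V] [InnerProductSpace ℝ V] [FiniteDimensional ℝ V]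
  [MeasurableSpace V] [BorelSpace V]

lemma lintegral_comp_norm_sq {d : ℕ} (hd : 0 < d) (hV : finrank ℝ V = d) {g : ℝ → ENNReal}
    (hg : Measurable g) :
    ∫⁻ v : V, g (‖v‖ ^ 2) =
      radialConst d * ∫⁻ t in Ioi (0 : ℝ), ENNReal.ofReal (t ^ ((d : ℝ) / 2 - 1)) * g t := by
  subst hV
  rw [← lintegral_comp_norm_sq_euclidean hd hg,
    ← (stdOrthonormalBasis ℝ V).repr.measurePreserving.lintegral_comp (by fun_prop)]
  simp

end Radial

/-! ### Joint image of Lebesgue measure under a linear map and the squared norm -/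

section LinearImage

variable {E F : Type*} [NormedAddCommGroup E] [InnerProductSpace ℝ E] [FiniteDimensional ℝ E]
  [MeasurableSpace E] [BorelSpace E] [NormedAddCommGroup F] [InnerProductSpace ℝ F]
  [FiniteDimensional ℝ F] [MeasurableSpace F] [BorelSpace F]

/-- Precomposing `T` with a linear isometry `U : F → E` gives an endomorphism `S` with `S S* = T
T*`, so the Jacobian is `|det S| = det (T T*)^(1/2)`. -/
lemma lintegral_comp_linear_of_finrank_eq (T : E →ₗ[ℝ] F) (h : finrank ℝ E = finrank ℝ F)
    (hdet : 0 < LinearMap.det (T ∘ₗ LinearMap.adjoint T)) {H : F → ENNReal} (hH : Measurable H) :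
    ∫⁻ x, H (T x) =
      ENNReal.ofReal (LinearMap.det (T ∘ₗ LinearMap.adjoint T) ^ (-(1 / 2) : ℝ)) * ∫⁻ w, H w := by
  let U : F ≃ₗᵢ[ℝ] E := (stdOrthonormalBasis ℝ F).equiv (stdOrthonormalBasis ℝ E) (finCongr h.symm)
  let S : F →ₗ[ℝ] F := T ∘ₗ U.toLinearEquiv.toLinearMap
  have hS : LinearMap.det S ^ 2 = LinearMap.det (T ∘ₗ LinearMap.adjoint T) := by
    have h1 : S ∘ₗ LinearMap.adjoint S = T ∘ₗ LinearMap.adjoint T := by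
      ext x
      simp [S, LinearMap.adjoint_comp, U.adjoint_toLinearMap_eq_symm]
    have h2 := LinearMap.normDet_sq S
    rw [LinearMap.normDet_eq_abs_det] at h2
    simp only [RCLike.ofReal_real_eq_id, id, sq_abs] at h2
    rw [h2, ← h1, LinearMap.det_comp, LinearMap.det_comp, mul_comm]
  have hS0 : LinearMap.det S ≠ 0 := by
    rintro h0
    rw [← hS, h0] at hdet
    simp at hdet
  have hconst : |(LinearMap.det S)⁻¹| = LinearMap.det (T ∘ₗ LinearMap.adjoint T) ^ (-(1 / 2) : ℝ) := by
    rw [← hS, Real.rpow_neg (sq_nonneg _), ← Real.sqrt_eq_rpow, Real.sqrt_sq_eq_abs, abs_inv]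
  rw [← U.measurePreserving.lintegral_comp (f := fun x => H (T x))
    (hH.comp (LinearMap.continuous_of_finiteDimensional T).measurable)]
  have hSm : Measurable S := (LinearMap.continuous_of_finiteDimensional S).measurable
  calc ∫⁻ w, H (T (U w)) = ∫⁻ w, H (S w) := rfl
    _ = ∫⁻ w, H w ∂(volume.map S) := (lintegral_map hH hSm).symm
    _ = _ := by
      rw [Measure.map_linearMap_addHaar_eq_smul_addHaar _ hS0, lintegral_smul_measure, hconst,
        smul_eq_mul]

/-- The joint law of a linear image `L y` and of `‖y‖ ^ 2` under Lebesgue measure. -/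
lemma lintegral_linear_norm_sq (L : E →ₗ[ℝ] F) (N : F →ₗ[ℝ] F)
    (hN : ∀ w, L (LinearMap.adjoint L (N w)) = w)
    (hdet : 0 < LinearMap.det (L ∘ₗ LinearMap.adjoint L)) {d : ℕ} (hd : 0 < d)
    (hfin : finrank ℝ E = finrank ℝ F + d) {g : F × ℝ → ENNReal} (hg : Measurable g) :
    ∫⁻ y, g (L y, ‖y‖ ^ 2) =
      radialConst d * ENNReal.ofReal (LinearMap.det (L ∘ₗ LinearMap.adjoint L) ^ (-(1 / 2) : ℝ)) *
        ∫⁻ w, ∫⁻ a in Ioi (inner ℝ w (N w)),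
          ENNReal.ofReal ((a - inner ℝ w (N w)) ^ ((d : ℝ) / 2 - 1)) * g (w, a) := by
  set K := LinearMap.ker L
  have hLc : Measurable L := (LinearMap.continuous_of_finiteDimensional L).measurable
  have hNc : Measurable N := (LinearMap.continuous_of_finiteDimensional N).measurable
  have hsurj : Function.Surjective L := fun w => ⟨_, hN w⟩
  have hrank : finrank ℝ F + finrank ℝ K = finrank ℝ E := by
    have := L.finrank_range_add_finrank_ker
    rwa [LinearMap.range_eq_top.2 hsurj, finrank_top] at this
  have hK : finrank ℝ K = d := by omega
  have hKo : finrank ℝ Kᗮ = finrank ℝ F := by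
    have := K.finrank_add_finrank_orthogonal
    omega
  let T : Kᗮ →ₗ[ℝ] F := L ∘ₗ Kᗮ.subtype
  have hadj_mem : ∀ u, LinearMap.adjoint L u ∈ Kᗮ := by
    intro u
    rw [Submodule.mem_orthogonal]
    intro k hk
    rw [LinearMap.adjoint_inner_right, LinearMap.mem_ker.1 hk, inner_zero_left]
  have hTadj : ∀ u, (LinearMap.adjoint T u : E) = LinearMap.adjoint L u := by
    intro u
    have : LinearMap.adjoint T u = ⟨LinearMap.adjoint L u, hadj_mem u⟩ := by
      refine ext_inner_left ℝ fun v => ?_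
      rw [LinearMap.adjoint_inner_right, Submodule.coe_inner, LinearMap.adjoint_inner_right]
      rfl
    rw [this]
  have hTT : T ∘ₗ LinearMap.adjoint T = L ∘ₗ LinearMap.adjoint L := by
    ext u
    exact congrArg L (hTadj u)
  -- A vector of `Kᗮ` is recovered from its image as `x = L* N (L x)`: the difference lies in `K ⊓
  -- Kᗮ`.
  have hnorm : ∀ x : Kᗮ, ‖x‖ ^ 2 = inner ℝ (T x) (N (T x)) := by
    intro x
    have hx : x = LinearMap.adjoint T (N (T x)) := by
      have hmem : (x : E) - LinearMap.adjoint L (N (L x)) ∈ K ⊓ Kᗮ :=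
        ⟨LinearMap.mem_ker.2 (by rw [map_sub, hN, sub_self]),
          Kᗮ.sub_mem x.2 (hadj_mem _)⟩
      rw [Submodule.inf_orthogonal_eq_bot, Submodule.mem_bot, sub_eq_zero] at hmem
      apply Subtype.ext
      rw [hTadj]
      exact hmem
    conv_lhs => rw [← real_inner_self_eq_norm_sq]
    conv_lhs => rw [hx, LinearMap.adjoint_inner_left, ← hx, real_inner_comm]
  have hsplit : ∫⁻ y, g (L y, ‖y‖ ^ 2) =
      ∫⁻ x : Kᗮ, ∫⁻ k : K, g (T x, ‖k‖ ^ 2 + ‖x‖ ^ 2) := by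
    let φ : E → K × Kᗮ := fun y => WithLp.ofLp (K.orthogonalDecomposition y)
    have hφ : MeasurePreserving φ := (WithLp.volume_preserving_ofLp K Kᗮ).comp
      K.orthogonalDecomposition.measurePreserving
    rw [← lintegral_prod_symm (μ := (volume : Measure K)) (ν := (volume : Measure Kᗮ))
      (fun p : K × Kᗮ => g (T p.2, ‖p.1‖ ^ 2 + ‖p.2‖ ^ 2)) ?_,
      ← Measure.volume_eq_prod, ← hφ.lintegral_comp ?_]
    · refine lintegral_congr fun y => ?_
      have h1 : ‖y‖ ^ 2 = ‖(φ y).1‖ ^ 2 + ‖(φ y).2‖ ^ 2 := by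
        rw [← K.orthogonalDecomposition.norm_map y, WithLp.prod_norm_sq_eq_of_L2]
        rfl
      have h2 : L y = T (φ y).2 := by
        have : y = ((φ y).1 : E) + (φ y).2 := by
          simp [φ]
        conv_lhs => rw [this]
        rw [map_add, LinearMap.mem_ker.1 (φ y).1.2, zero_add]
        rfl
      rw [h1, h2]
    all_goals
      have hT : Measurable T := (LinearMap.continuous_of_finiteDimensional T).measurable
    · fun_prop
    · fun_prop
  -- Radial integration over the kernel in `t = ‖k‖²`, then the translation `a = t + ‖x‖²`.
  have hinner : ∀ x : Kᗮ, ∫⁻ k : K, g (T x, ‖k‖ ^ 2 + ‖x‖ ^ 2) =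
      radialConst d * (fun w => ∫⁻ a in Ioi (inner ℝ w (N w)),
          ENNReal.ofReal ((a - inner ℝ w (N w)) ^ ((d : ℝ) / 2 - 1)) * g (w, a)) (T x) := by
    intro x
    rw [lintegral_comp_norm_sq hd hK (g := fun t => g (T x, t + ‖x‖ ^ 2)) (by fun_prop), hnorm x]
    congr 1
    set c := inner ℝ (T x) (N (T x))
    simp only
    rw [← lintegral_indicator measurableSet_Ioi, ← lintegral_indicator measurableSet_Ioi,
      ← lintegral_sub_right_eq_self _ c]
    refine lintegral_congr fun a => ?_
    simp only [indicator, mem_Ioi, sub_pos, sub_add_cancel]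
    rfl
  have hmeas : Measurable fun w => ∫⁻ a in Ioi (inner ℝ w (N w)),
      ENNReal.ofReal ((a - inner ℝ w (N w)) ^ ((d : ℝ) / 2 - 1)) * g (w, a) := by
    simp_rw [← lintegral_indicator measurableSet_Ioi]
    refine Measurable.lintegral_prod_right' (f := fun p : F × ℝ => (Ioi (inner ℝ p.1 (N p.1))).indicator
      (fun a => ENNReal.ofReal ((a - inner ℝ p.1 (N p.1)) ^ ((d : ℝ) / 2 - 1)) * g (p.1, a)) p.2) ?_
    simp only [indicator, mem_Ioi]
    refine Measurable.ite (measurableSet_lt ?_ ?_) ?_ ?_ <;> fun_prop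
  rw [hsplit]
  simp_rw [hinner]
  rw [lintegral_const_mul, lintegral_comp_linear_of_finrank_eq T hKo (by rw [hTT]; exact hdet) hmeas,
    hTT, mul_assoc]
  exact hmeas.comp (LinearMap.continuous_of_finiteDimensional T).measurable

end LinearImage

/-! ### Identities in composition algebras, without associativity -/

section CompositionAlgebra

set_option linter.unusedSectionVars false

variable {𝔄 : Type*} [NormedAddCommGroup 𝔄] [InnerProductSpace ℝ 𝔄] [Mul 𝔄] [One 𝔄]
  [RealNormedDivisionAlgebra 𝔄]

lemma alg_zero_mul (x : 𝔄) : (0 : 𝔄) * x = 0 := by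
  simpa using RealNormedDivisionAlgebra.smul_mul (0 : ℝ) (0 : 𝔄) x

lemma alg_mul_zero (x : 𝔄) : x * (0 : 𝔄) = 0 := by
  simpa using RealNormedDivisionAlgebra.mul_smul (0 : ℝ) x (0 : 𝔄)

lemma alg_sub_mul (x y z : 𝔄) : (x - y) * z = x * z - y * z := by
  rw [sub_eq_add_neg, RealNormedDivisionAlgebra.add_mul, ← neg_one_smul ℝ y, RealNormedDivisionAlgebra.smul_mul,
    neg_one_smul, ← sub_eq_add_neg]

lemma alg_mul_sub (x y z : 𝔄) : x * (y - z) = x * y - x * z := by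
  rw [sub_eq_add_neg, RealNormedDivisionAlgebra.mul_add, ← neg_one_smul ℝ z,
    RealNormedDivisionAlgebra.mul_smul, neg_one_smul, ← sub_eq_add_neg]

lemma alg_sum_mul {ι : Type*} (s : Finset ι) (f : ι → 𝔄) (x : 𝔄) :
    (∑ i ∈ s, f i) * x = ∑ i ∈ s, f i * x := by
  classical
  induction s using Finset.induction_on with
  | empty => simp [alg_zero_mul]
  | insert a s ha ih => simp [Finset.sum_insert ha, RealNormedDivisionAlgebra.add_mul, ih]

lemma alg_mul_sum {ι : Type*} (s : Finset ι) (f : ι → 𝔄) (x : 𝔄) :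
    x * (∑ i ∈ s, f i) = ∑ i ∈ s, x * f i := by
  classical
  induction s using Finset.induction_on with
  | empty => simp [alg_mul_zero]
  | insert a s ha ih => simp [Finset.sum_insert ha, RealNormedDivisionAlgebra.mul_add, ih]

lemma inner_one_one : inner ℝ (1 : 𝔄) 1 = 1 := by
  have h := RealNormedDivisionAlgebra.inner_mul_self (1 : 𝔄) 1
  rw [RealNormedDivisionAlgebra.one_mul] at h
  have h0 : inner ℝ (1 : 𝔄) 1 ≠ 0 := by
    rw [inner_self_ne_zero]
    exact RealNormedDivisionAlgebra.one_ne_zero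
  exact (mul_eq_left₀ h0).1 h.symm

lemma inner_mul_mul_left (x y z : 𝔄) :
    inner ℝ (x * y) (x * z) = inner ℝ x x * inner ℝ y z := by
  have h := RealNormedDivisionAlgebra.inner_mul_self x (y + z)
  rw [RealNormedDivisionAlgebra.mul_add, real_inner_add_add_self, real_inner_add_add_self,
    RealNormedDivisionAlgebra.inner_mul_self, RealNormedDivisionAlgebra.inner_mul_self] at h
  linarith

/-- The composition law polarised in both factors. Setting one argument to 1 yields the adjoints of
left and right multiplication, `inner_mul_left_eq` and `inner_mul_right_eq`. -/
lemma inner_mul_mul_add (x y w z : 𝔄) :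
    inner ℝ (x * y) (w * z) + inner ℝ (w * y) (x * z) = 2 * inner ℝ x w * inner ℝ y z := by
  have h := inner_mul_mul_left (x + w) y z
  rw [RealNormedDivisionAlgebra.add_mul, RealNormedDivisionAlgebra.add_mul,
    real_inner_add_add_self, inner_add_left, inner_add_right, inner_add_right,
    inner_mul_mul_left, inner_mul_mul_left] at h
  linarith

lemma conj_add (x y : 𝔄) : conj (x + y) = conj x + conj y := by
  simp only [conj, rePart, inner_add_right]
  module

lemma conj_smul (c : ℝ) (x : 𝔄) : conj (c • x) = c • conj x := by
  simp only [conj, rePart, inner_smul_right, smul_sub, smul_smul]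
  congr 2
  ring

variable (𝔄) in
/-- Conjugation as a linear map. -/
noncomputable def conjL : 𝔄 →ₗ[ℝ] 𝔄 where
  toFun := conj
  map_add' := conj_add
  map_smul' := conj_smul

lemma conj_sum {ι : Type*} (s : Finset ι) (f : ι → 𝔄) :
    conj (∑ i ∈ s, f i) = ∑ i ∈ s, conj (f i) :=
  map_sum (conjL 𝔄) f s

lemma conj_one : conj (1 : 𝔄) = 1 := by
  simp only [conj, rePart, inner_one_one]
  module

lemma conj_conj (x : 𝔄) : conj (conj x) = x := by
  simp only [conj, rePart, inner_sub_right, inner_smul_right, inner_one_one]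
  module

lemma inner_conj_left (x y : 𝔄) : inner ℝ (conj x) y = inner ℝ x (conj y) := by
  simp only [conj, rePart, inner_sub_right, inner_smul_right, inner_sub_left, inner_smul_left,
    real_inner_comm]
  simp only [RCLike.conj_to_real]
  ring

lemma inner_mul_left_eq (x y z : 𝔄) : inner ℝ (x * y) z = inner ℝ y (conj x * z) := by
  have h := inner_mul_mul_add x y 1 z
  rw [RealNormedDivisionAlgebra.one_mul, RealNormedDivisionAlgebra.one_mul] at h
  rw [conj, alg_sub_mul, RealNormedDivisionAlgebra.smul_mul, RealNormedDivisionAlgebra.one_mul, inner_sub_right,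
    inner_smul_right, rePart, real_inner_comm x 1]
  linarith

lemma inner_mul_right_eq (x y z : 𝔄) : inner ℝ (x * y) z = inner ℝ x (z * conj y) := by
  have h := inner_mul_mul_add x y z 1
  rw [RealNormedDivisionAlgebra.mul_one, RealNormedDivisionAlgebra.mul_one] at h
  rw [conj, alg_mul_sub, RealNormedDivisionAlgebra.mul_smul, RealNormedDivisionAlgebra.mul_one,
    inner_sub_right, inner_smul_right, rePart, real_inner_comm y 1, real_inner_comm (z * y) x]
  linarith

lemma conj_mul (x y : 𝔄) : conj (x * y) = conj y * conj x := by
  refine ext_inner_right ℝ fun z => ?_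
  rw [inner_conj_left, inner_mul_left_eq, real_inner_comm, inner_mul_right_eq, conj_conj,
    inner_mul_left_eq, real_inner_comm, conj_conj, real_inner_comm]

/-- Left multiplication by `x` scales inner products by `‖x‖²`, and its adjoint is left
multiplication by `conj x`. This is the substitute for associativity in the octonionic case. -/
lemma conj_mul_mul (x z : 𝔄) : conj x * (x * z) = (inner ℝ x x : ℝ) • z := by
  refine ext_inner_right ℝ fun w => ?_
  rw [inner_mul_left_eq, conj_conj, inner_mul_mul_left, inner_smul_left]
  rfl

lemma conj_mul_self (x : 𝔄) : conj x * x = (inner ℝ x x : ℝ) • (1 : 𝔄) := by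
  simpa only [RealNormedDivisionAlgebra.mul_one] using conj_mul_mul x 1

lemma eq_smul_one_of_conj_eq {x : 𝔄} (h : conj x = x) : x = rePart x • (1 : 𝔄) := by
  rw [conj, sub_eq_iff_eq_add, ← two_smul ℝ x, SemigroupAction.mul_smul] at h
  exact (smul_right_injective 𝔄 (two_ne_zero' ℝ) h).symm

lemma conj_smul_one (a : ℝ) : conj (a • (1 : 𝔄)) = a • 1 := by
  rw [conj_smul, conj_one]

lemma rePart_smul_one (a : ℝ) : rePart (a • (1 : 𝔄)) = a := by
  rw [rePart, inner_smul_right, inner_one_one, _root_.mul_one]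

lemma smul_one_mul (a : ℝ) (x : 𝔄) : (a • (1 : 𝔄)) * x = a • x := by
  rw [RealNormedDivisionAlgebra.smul_mul, RealNormedDivisionAlgebra.one_mul]

variable (𝔄) in
lemma finrank_alg_pos [FiniteDimensional ℝ 𝔄] : 0 < finrank ℝ 𝔄 :=
  finrank_pos_iff_exists_ne_zero.2 ⟨1, RealNormedDivisionAlgebra.one_ne_zero⟩

variable (𝔄) in
lemma algDim_pos [FiniteDimensional ℝ 𝔄] : 0 < algDim 𝔄 :=
  Nat.cast_pos.2 (finrank_alg_pos 𝔄)

end CompositionAlgebra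

/-! ### Schur complement formula for block linear maps -/

section BlockDet

variable {F G : Type*} [AddCommGroup F] [Module ℝ F] [FiniteDimensional ℝ F] [AddCommGroup G]
  [Module ℝ G] [FiniteDimensional ℝ G]

lemma det_block (B N : F →ₗ[ℝ] F) (hBN : B ∘ₗ N = LinearMap.id) (W : G →ₗ[ℝ] F) (V : F →ₗ[ℝ] G)
    (D : G →ₗ[ℝ] G) :
    LinearMap.det ((B.coprod W).prod (V.coprod D)) =
      LinearMap.det B * LinearMap.det (D - V ∘ₗ N ∘ₗ W) := by
  let b := Module.finBasis ℝ F
  let c := Module.finBasis ℝ G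
  have hmat : LinearMap.toMatrix (b.prod c) (b.prod c) ((B.coprod W).prod (V.coprod D)) =
      Matrix.fromBlocks (LinearMap.toMatrix b b B) (LinearMap.toMatrix c b W)
        (LinearMap.toMatrix b c V) (LinearMap.toMatrix c c D) := by
    ext i j
    rcases i with i | i <;> rcases j with j | j <;> simp [LinearMap.toMatrix_apply]
  have hinv : LinearMap.toMatrix b b B * LinearMap.toMatrix b b N = 1 := by
    rw [← LinearMap.toMatrix_comp, hBN, LinearMap.toMatrix_id]
  let : Invertible (LinearMap.toMatrix b b B) :=
    ⟨LinearMap.toMatrix b b N, mul_eq_one_comm.1 hinv, hinv⟩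
  rw [← LinearMap.det_toMatrix (b.prod c), hmat, Matrix.det_fromBlocks₁₁, LinearMap.det_toMatrix,
    ← LinearMap.det_toMatrix c (D - V ∘ₗ N ∘ₗ W), map_sub, LinearMap.toMatrix_comp c b c,
    LinearMap.toMatrix_comp c b b, Matrix.mul_assoc]
  rfl

end BlockDet

/-! ### Hermitian matrices, bordering and Gram matrices -/

section HermitianMatrices

set_option linter.unusedSectionVars false

variable {𝔄 : Type*} [NormedAddCommGroup 𝔄] [InnerProductSpace ℝ 𝔄] [Mul 𝔄] [One 𝔄]

/-- The real inner product of two columns. -/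
noncomputable def colInner {m : ℕ} (u v : Fin m → 𝔄) : ℝ := ∑ i, inner ℝ (u i) (v i)

lemma colInner_eq_inner {m : ℕ} (u v : Fin m → 𝔄) :
    colInner u v = inner ℝ (WithLp.toLp 2 u) (WithLp.toLp 2 v) := by
  simp [colInner, PiLp.inner_apply]

lemma colInner_comm {m : ℕ} (u v : Fin m → 𝔄) : colInner u v = colInner v u := by
  simp [colInner, real_inner_comm]

lemma colInner_add_left {m : ℕ} (u v w : Fin m → 𝔄) :
    colInner (u + v) w = colInner u w + colInner v w := by
  simp [colInner, inner_add_left, Finset.sum_add_distrib]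

lemma colInner_add_right {m : ℕ} (u v w : Fin m → 𝔄) :
    colInner u (v + w) = colInner u v + colInner u w := by
  simp [colInner, inner_add_right, Finset.sum_add_distrib]

lemma colInner_snoc {m : ℕ} (u v : Fin m → 𝔄) (s t : 𝔄) :
    colInner (Fin.snoc (α := fun _ => 𝔄) u s : Fin (m + 1) → 𝔄) (Fin.snoc (α := fun _ => 𝔄) v t) =
      colInner u v + inner ℝ s t := by
  simp [colInner, Fin.sum_univ_castSucc]

/-- The Hermitian matrix obtained from the Hermitian matrix `A` by adding `w` as a last column,
its conjugate as a last row, and `a` as the last diagonal entry. -/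
noncomputable def border {m : ℕ} (A : Matrix (Fin m) (Fin m) 𝔄) (w : Fin m → 𝔄) (a : ℝ) :
    Matrix (Fin (m + 1)) (Fin (m + 1)) 𝔄 :=
  Matrix.of (Fin.snoc (α := fun _ => Fin (m + 1) → 𝔄)
    (fun i => Fin.snoc (α := fun _ => 𝔄) (A i) (w i))
    (Fin.snoc (α := fun _ => 𝔄) (fun j => conj (w j)) (a • (1 : 𝔄))))

section Entries

variable {m : ℕ} (A : Matrix (Fin m) (Fin m) 𝔄) (w : Fin m → 𝔄) (a : ℝ)

@[simp] lemma border_castSucc_castSucc (i j : Fin m) :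
    border A w a i.castSucc j.castSucc = A i j := by
  simp [border]

@[simp] lemma border_castSucc_last (i : Fin m) :
    border A w a i.castSucc (Fin.last m) = w i := by
  simp [border]

@[simp] lemma border_last_castSucc (j : Fin m) :
    border A w a (Fin.last m) j.castSucc = conj (w j) := by
  simp [border]

@[simp] lemma border_last_last : border A w a (Fin.last m) (Fin.last m) = a • (1 : 𝔄) := by
  simp [border]

end Entries

variable [RealNormedDivisionAlgebra 𝔄]

lemma isHermitian_border {m : ℕ} {A : Matrix (Fin m) (Fin m) 𝔄} {w : Fin m → 𝔄} {a : ℝ} :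
    IsHermitian (border A w a) ↔ IsHermitian A := by
  constructor
  · intro h i j
    simpa using h i.castSucc j.castSucc
  · intro h i j
    induction i using Fin.lastCases <;> induction j using Fin.lastCases
    · simp [conj_smul_one]
    · simp [conj_conj]
    · simp
    · simpa using h _ _

lemma leftMul_apply {m : ℕ} (A : Matrix (Fin m) (Fin m) 𝔄) (v : Fin m → 𝔄) (i : Fin m) :
    leftMul A v i = ∑ j, A i j * v j := rfl

/-- Entrywise, the adjoint of multiplication by `A i j` is multiplication by its conjugate `A j i`;
no associativity is involved. -/
lemma colInner_leftMul {m : ℕ} {A : Matrix (Fin m) (Fin m) 𝔄} (hA : IsHermitian A)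
    (u v : Fin m → 𝔄) : colInner (leftMul A u) v = colInner u (leftMul A v) := by
  simp only [colInner, leftMul_apply, sum_inner, inner_sum]
  rw [Finset.sum_comm]
  refine Finset.sum_congr rfl fun j _ => Finset.sum_congr rfl fun i _ => ?_
  rw [inner_mul_left_eq, hA i j]

lemma isPosDef_iff {m : ℕ} {A : Matrix (Fin m) (Fin m) 𝔄} :
    IsPosDef A ↔ IsHermitian A ∧ ∀ v : Fin m → 𝔄, v ≠ 0 → 0 < colInner v (leftMul A v) := Iff.rfl

lemma IsPosDef.colInner_nonneg {m : ℕ} {A : Matrix (Fin m) (Fin m) 𝔄} (hA : IsPosDef A)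
    (v : Fin m → 𝔄) : 0 ≤ colInner v (leftMul A v) := by
  rcases eq_or_ne v 0 with rfl | hv
  · simp [colInner]
  · exact ((isPosDef_iff.1 hA).2 v hv).le

/-- Left multiplication by the column `w` on scalars. -/
noncomputable def colMap {m : ℕ} (w : Fin m → 𝔄) : 𝔄 →ₗ[ℝ] (Fin m → 𝔄) where
  toFun s := fun i => w i * s
  map_add' s t := by
    funext i
    simp [RealNormedDivisionAlgebra.mul_add]
  map_smul' c s := by
    funext i
    simp [RealNormedDivisionAlgebra.mul_smul]

/-- The adjoint matrix product of the columns of `R` with a column, that is `y ↦ R* y`. -/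
noncomputable def starMul {n m : ℕ} (R : Matrix (Fin n) (Fin m) 𝔄) :
    (Fin n → 𝔄) →ₗ[ℝ] (Fin m → 𝔄) where
  toFun y := fun i => ∑ k, conj (R k i) * y k
  map_add' v w := by
    funext i
    simp [RealNormedDivisionAlgebra.mul_add, Finset.sum_add_distrib]
  map_smul' c v := by
    funext i
    simp [RealNormedDivisionAlgebra.mul_smul, Finset.smul_sum]

/-- Left multiplication by a row that is the conjugate transpose of the column `w`. -/
noncomputable def rowMap {m : ℕ} (w : Fin m → 𝔄) : (Fin m → 𝔄) →ₗ[ℝ] 𝔄 where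
  toFun u := ∑ i, conj (w i) * u i
  map_add' v w := by
    simp [RealNormedDivisionAlgebra.mul_add, Finset.sum_add_distrib]
  map_smul' c v := by
    simp [RealNormedDivisionAlgebra.mul_smul, Finset.smul_sum]

lemma colInner_colMap {m : ℕ} (w u : Fin m → 𝔄) (s : 𝔄) :
    colInner (colMap w s) u = inner ℝ s (rowMap w u) := by
  simp [colInner, colMap, rowMap, inner_sum, inner_mul_left_eq]

lemma colMap_one {m : ℕ} (w : Fin m → 𝔄) : colMap w 1 = w := by
  funext i
  simp [colMap, RealNormedDivisionAlgebra.mul_one]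

variable [FiniteDimensional ℝ 𝔄]

/-- On the Euclidean space `𝔄 ^ m` the map is symmetric and positive, so its determinant is a
product of nonnegative eigenvalues; a zero determinant would give a kernel vector violating
definiteness. -/
lemma det_leftMul_pos {m : ℕ} {A : Matrix (Fin m) (Fin m) 𝔄} (hA : IsPosDef A) :
    0 < LinearMap.det (leftMul A) := by
  let e := (WithLp.linearEquiv 2 ℝ (Fin m → 𝔄)).symm
  let T : PiLp 2 (fun _ : Fin m => 𝔄) →ₗ[ℝ] PiLp 2 (fun _ : Fin m => 𝔄) :=
    e.toLinearMap ∘ₗ leftMul A ∘ₗ e.symm.toLinearMap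
  have hT : LinearMap.det T = LinearMap.det (leftMul A) := LinearMap.det_conj _ e
  have hsymm : T.IsSymmetric := by
    intro u v
    exact (colInner_eq_inner _ _).symm.trans ((colInner_leftMul hA.1 _ _).trans
      (colInner_eq_inner _ _))
  have hpos : T.IsPositive := by
    rw [LinearMap.isPositive_iff]
    refine ⟨hsymm, fun v => ?_⟩
    rw [hsymm]
    exact (hA.colInner_nonneg _).trans_eq (colInner_eq_inner _ _)
  have hnonneg : 0 ≤ LinearMap.det T := by
    rw [hsymm.det_eq_prod_eigenvalues rfl]
    exact Finset.prod_nonneg fun i _ => hpos.nonneg_eigenvalues rfl i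
  rw [← hT]
  refine hnonneg.lt_of_ne' fun h0 => ?_
  rw [hT] at h0
  obtain ⟨v, hv, hv0⟩ := Submodule.exists_mem_ne_zero_of_ne_bot
    (LinearMap.bot_lt_ker_of_det_eq_zero h0).ne'
  have := (isPosDef_iff.1 hA).2 v hv0
  rw [LinearMap.mem_ker.1 hv] at this
  simp [colInner] at this

/-- The inverse is kept as a linear map `N`, so nothing need be known about its being left
multiplication by a matrix. -/
lemma exists_leftMul_inverse {m : ℕ} {A : Matrix (Fin m) (Fin m) 𝔄} (hA : IsPosDef A) :
    ∃ N : (Fin m → 𝔄) →ₗ[ℝ] (Fin m → 𝔄), leftMul A ∘ₗ N = LinearMap.id :=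
  ⟨((leftMul A).equivOfDetNeZero (det_leftMul_pos hA).ne').symm.toLinearMap,
    LinearMap.ext fun v => ((leftMul A).equivOfDetNeZero (det_leftMul_pos hA).ne').apply_symm_apply v⟩

section Inverse

variable {m : ℕ} {A : Matrix (Fin m) (Fin m) 𝔄} {N : (Fin m → 𝔄) →ₗ[ℝ] (Fin m → 𝔄)}

lemma colInner_inverse (hA : IsHermitian A) (hN : leftMul A ∘ₗ N = LinearMap.id)
    (u v : Fin m → 𝔄) : colInner (N u) v = colInner u (N v) := by
  have h := fun x => LinearMap.congr_fun hN x
  simp only [LinearMap.comp_apply, LinearMap.id_apply] at h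
  conv_lhs => rw [← h v, ← colInner_leftMul hA, h]

lemma inverse_leftMul (hN : leftMul A ∘ₗ N = LinearMap.id) (v : Fin m → 𝔄) :
    N (leftMul A v) = v :=
  LinearMap.congr_fun ((LinearMap.comp_eq_id_comm ℝ _).1 hN) v

/-- The quadratic form `w* A⁻¹ w`, with scalars inserted in the middle of the product, is still a
real scalar: this is where associativity or a small size is needed. -/
lemma rowMap_inverse_colMap (hassoc : (∀ a b c : 𝔄, (a * b) * c = a * (b * c)) ∨ m ≤ 1)
    (hA : IsPosDef A) (hN : leftMul A ∘ₗ N = LinearMap.id) (w : Fin m → 𝔄) (s : 𝔄) :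
    rowMap w (N (colMap w s)) = colInner w (N w) • s := by
  have hAN := fun x => LinearMap.congr_fun hN x
  simp only [LinearMap.comp_apply, LinearMap.id_apply] at hAN
  rcases hassoc with hassoc | hm
  -- With associativity `leftMul A` commutes with right multiplication by scalars, hence so does its
  -- inverse.
  · have hcol : ∀ t, N (colMap w t) = fun i => N w i * t := by
      intro t
      rw [← inverse_leftMul hN (fun i => N w i * t)]
      congr 1
      funext i
      rw [leftMul_apply]
      simp_rw [← hassoc]
      rw [← alg_sum_mul, ← leftMul_apply, hAN]
      rfl
    have hrow : ∀ t, rowMap w (N (colMap w t)) = rowMap w (N w) * t := by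
      intro t
      rw [hcol]
      simp only [rowMap, LinearMap.coe_mk, AddHom.coe_mk, alg_sum_mul, hassoc]
    -- Symmetry of `N` makes the scalar `w* A⁻¹ w` self-conjugate, hence real.
    have hself : conj (rowMap w (N w)) = rowMap w (N w) := by
      refine ext_inner_right ℝ fun t => ?_
      have h1 : inner ℝ t (rowMap w (N w)) = inner ℝ (rowMap w (N (colMap w t))) 1 := by
        rw [← colInner_colMap, ← colInner_inverse hA.1 hN, real_inner_comm, ← colInner_colMap,
          colMap_one, colInner_comm]
      rw [real_inner_comm t (rowMap w (N w)), h1, hrow, inner_mul_left_eq,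
        RealNormedDivisionAlgebra.mul_one, real_inner_comm]
    have hre : rePart (rowMap w (N w)) = colInner w (N w) := by
      rw [rePart, ← colInner_colMap, colMap_one]
    rw [hrow, eq_smul_one_of_conj_eq hself, hre, smul_one_mul]
  -- In size 1 the matrix is a real scalar `α`, so `N` is `α⁻¹` and `conj_mul_mul` suffices.
  · interval_cases m
    · simp [rowMap, colInner]
    · obtain ⟨α, hα⟩ : ∃ α : ℝ, A 0 0 = α • (1 : 𝔄) := ⟨_, eq_smul_one_of_conj_eq (hA.1 0 0).symm⟩
      have hmul : ∀ v : Fin 1 → 𝔄, leftMul A v = α • v := by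
        intro v
        funext i
        rw [Subsingleton.elim i 0, leftMul_apply, Fin.sum_univ_one, hα, smul_one_mul]
        rfl
      have hα0 : α ≠ 0 := by
        rintro rfl
        have h := hAN (fun _ => 1)
        rw [hmul, zero_smul] at h
        exact RealNormedDivisionAlgebra.one_ne_zero (congrFun h 0).symm
      have hNv : ∀ v, N v = α⁻¹ • v := by
        intro v
        rw [eq_inv_smul_iff₀ hα0, ← hmul, hAN]
      rw [hNv, hNv, map_smul]
      simp [rowMap, colMap, colInner, conj_mul_mul, inner_smul_right, smul_smul]

end Inverse

/-- `Fin.snoc` as a linear equivalence. -/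
def snocLinear (m : ℕ) : ((Fin m → 𝔄) × 𝔄) ≃ₗ[ℝ] (Fin (m + 1) → 𝔄) where
  toFun p := Fin.snoc (α := fun _ => 𝔄) p.1 p.2
  invFun v := (fun i => v i.castSucc, v (Fin.last m))
  map_add' p q := by
    funext i
    induction i using Fin.lastCases <;> simp
  map_smul' c p := by
    funext i
    induction i using Fin.lastCases <;> simp
  left_inv p := by simp
  right_inv v := by
    funext i
    induction i using Fin.lastCases <;> simp

lemma leftMul_border_snoc {m : ℕ} (A : Matrix (Fin m) (Fin m) 𝔄) (w : Fin m → 𝔄) (a : ℝ)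
    (u : Fin m → 𝔄) (s : 𝔄) :
    leftMul (border A w a) (Fin.snoc (α := fun _ => 𝔄) u s) =
      Fin.snoc (α := fun _ => 𝔄) (leftMul A u + colMap w s) (rowMap w u + a • s) := by
  funext i
  induction i using Fin.lastCases <;>
    simp [leftMul_apply, Fin.sum_univ_castSucc, colMap, rowMap, smul_one_mul]

section Schur

variable {m : ℕ} {A : Matrix (Fin m) (Fin m) 𝔄} {N : (Fin m → 𝔄) →ₗ[ℝ] (Fin m → 𝔄)}

/-- In the splitting `𝔄 ^ m × 𝔄` the Schur complement is the real scalar `a - w* A⁻¹ w` times the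
identity of `𝔄`, which contributes its `β`-th power. -/
lemma det_leftMul_border (hassoc : (∀ a b c : 𝔄, (a * b) * c = a * (b * c)) ∨ m ≤ 1)
    (hA : IsPosDef A) (hN : leftMul A ∘ₗ N = LinearMap.id) (w : Fin m → 𝔄) (a : ℝ) :
    LinearMap.det (leftMul (border A w a)) =
      LinearMap.det (leftMul A) * (a - colInner w (N w)) ^ finrank ℝ 𝔄 := by
  have h1 : leftMul (border A w a) = (snocLinear m).toLinearMap ∘ₗ
      (((leftMul A).coprod (colMap w)).prod ((rowMap w).coprod (a • LinearMap.id))) ∘ₗ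
        (snocLinear m).symm.toLinearMap := by
    refine LinearMap.ext fun v => ?_
    obtain ⟨p, rfl⟩ := (snocLinear (𝔄 := 𝔄) m).surjective v
    simp only [LinearMap.comp_apply, LinearEquiv.coe_coe, LinearEquiv.symm_apply_apply]
    exact leftMul_border_snoc A w a p.1 p.2
  have h2 : a • LinearMap.id - rowMap w ∘ₗ N ∘ₗ colMap w =
      (a - colInner w (N w)) • (LinearMap.id : 𝔄 →ₗ[ℝ] 𝔄) := by
    ext s
    simp only [LinearMap.sub_apply, LinearMap.comp_apply, LinearMap.smul_apply, LinearMap.id_apply,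
      rowMap_inverse_colMap hassoc hA hN, sub_smul]
  rw [h1, LinearMap.det_conj, det_block _ N hN, h2, LinearMap.det_smul, LinearMap.det_id,
    _root_.mul_one]

lemma IsPosDef.of_border {w : Fin m → 𝔄} {a : ℝ} (h : IsPosDef (border A w a)) : IsPosDef A := by
  rw [isPosDef_iff] at h ⊢
  refine ⟨isHermitian_border.1 h.1, fun v hv => ?_⟩
  have h2 := h.2 (Fin.snoc (α := fun _ => 𝔄) v 0) ?_
  · rw [leftMul_border_snoc, colInner_snoc, map_zero, add_zero, inner_zero_left, add_zero] at h2
    exact h2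
  · intro h0
    apply hv
    funext i
    simpa using congrFun h0 i.castSucc

/-- Completing the square: at `(u, s)` the quadratic form is that of `A` at `u + A⁻¹ (w s)` plus `(a
- w* A⁻¹ w) ‖s‖²`. -/
lemma isPosDef_border_iff (hassoc : (∀ a b c : 𝔄, (a * b) * c = a * (b * c)) ∨ m ≤ 1)
    (hA : IsPosDef A) (hN : leftMul A ∘ₗ N = LinearMap.id) (w : Fin m → 𝔄) (a : ℝ) :
    IsPosDef (border A w a) ↔ colInner w (N w) < a := by
  have hAN := fun x => LinearMap.congr_fun hN x
  simp only [LinearMap.comp_apply, LinearMap.id_apply] at hAN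
  have key : ∀ (u : Fin m → 𝔄) (s : 𝔄),
      colInner (Fin.snoc (α := fun _ => 𝔄) u s : Fin (m + 1) → 𝔄)
        (leftMul (border A w a) (Fin.snoc (α := fun _ => 𝔄) u s)) =
      colInner (u + N (colMap w s)) (leftMul A (u + N (colMap w s))) +
        (a - colInner w (N w)) * inner ℝ s s := by
    intro u s
    have h1 : inner ℝ s (rowMap w u) = colInner (colMap w s) u := (colInner_colMap w u s).symm
    have h2 : colInner (N (colMap w s)) (colMap w s) = colInner w (N w) * inner ℝ s s := by
      rw [colInner_comm, colInner_colMap, rowMap_inverse_colMap hassoc hA hN, inner_smul_right]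
    have h3 : colInner (N (colMap w s)) (leftMul A u) = colInner (colMap w s) u := by
      rw [← colInner_leftMul hA.1, hAN]
    rw [leftMul_border_snoc, colInner_snoc, map_add, hAN, colInner_add_right, colInner_add_left,
      colInner_add_right, colInner_add_right, inner_add_right, inner_smul_right, h1, h2, h3]
    ring
  constructor
  · intro h
    -- This test vector makes the completed square vanish and leaves only the Schur complement.
    have h2 := (isPosDef_iff.1 h).2 (Fin.snoc (α := fun _ => 𝔄) (-N (colMap w 1)) 1) ?_
    · rw [key, inner_one_one, neg_add_cancel] at h2
      simp only [map_zero, colInner, Pi.zero_apply, inner_zero_left, Finset.sum_const_zero] at h2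
      simp only [colInner]
      linarith
    · intro h0
      exact RealNormedDivisionAlgebra.one_ne_zero (by simpa using congrFun h0 (Fin.last m))
  · intro h
    rw [isPosDef_iff]
    refine ⟨isHermitian_border.2 hA.1, fun v hv => ?_⟩
    obtain ⟨⟨u, s⟩, rfl⟩ := (snocLinear (𝔄 := 𝔄) m).surjective v
    change 0 < colInner (Fin.snoc (α := fun _ => 𝔄) u s : Fin (m + 1) → 𝔄)
        (leftMul (border A w a) (Fin.snoc (α := fun _ => 𝔄) u s))
    rw [key]
    rcases eq_or_ne s 0 with rfl | hs
    · have hu : u ≠ 0 := by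
        rintro rfl
        exact hv (map_zero (snocLinear (𝔄 := 𝔄) m))
      simpa using (isPosDef_iff.1 hA).2 u hu
    · exact add_pos_of_nonneg_of_pos (hA.colInner_nonneg _)
        (mul_pos (sub_pos.2 h) (real_inner_self_pos.2 hs))

lemma detPos_pos (hA : IsPosDef A) : 0 < detPos A := Real.rpow_pos_of_pos (det_leftMul_pos hA) _

/-- Turns the Jacobian `det (leftMul A)^(-1/2)` into `|A|^(-β/2)`. -/
lemma detPos_rpow_algDim (hA : IsPosDef A) (p : ℝ) :
    LinearMap.det (leftMul A) ^ p = detPos A ^ (algDim 𝔄 * p) := by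
  rw [detPos, ← Real.rpow_mul (det_leftMul_pos hA).le, ← mul_assoc,
    one_div_mul_cancel (algDim_pos 𝔄).ne', _root_.one_mul]

lemma detPos_border (hassoc : (∀ a b c : 𝔄, (a * b) * c = a * (b * c)) ∨ m ≤ 1)
    (hA : IsPosDef A) (hN : leftMul A ∘ₗ N = LinearMap.id) {w : Fin m → 𝔄} {a : ℝ}
    (ha : colInner w (N w) < a) :
    detPos (border A w a) = detPos A * (a - colInner w (N w)) := by
  have h0 : 0 ≤ a - colInner w (N w) := (sub_pos.2 ha).le
  rw [detPos, det_leftMul_border hassoc hA hN,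
    Real.mul_rpow (det_leftMul_pos hA).le (pow_nonneg h0 _), ← detPos, ← Real.rpow_natCast,
    ← Real.rpow_mul h0, ← algDim, mul_one_div_cancel (algDim_pos 𝔄).ne', Real.rpow_one]

end Schur

section Gram

variable {n m : ℕ}

lemma starMulSelf_snoc (R : Matrix (Fin n) (Fin m) 𝔄) (y : Fin n → 𝔄) :
    starMulSelf (Matrix.of fun k => (Fin.snoc (α := fun _ => 𝔄) (R k) (y k) : Fin (m + 1) → 𝔄)) =
      border (starMulSelf R) (starMul R y) (colInner y y) := by
  ext i j
  induction i using Fin.lastCases <;> induction j using Fin.lastCases <;>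
    simp [starMulSelf, starMul, conj_sum, conj_mul, conj_conj, conj_mul_self, colInner,
      Finset.sum_smul]

/-- Identifies the adjoint of `y ↦ R* y` as `u ↦ R u`, again entry by entry and without
associativity. -/
lemma colInner_starMul (R : Matrix (Fin n) (Fin m) 𝔄) (y : Fin n → 𝔄) (u : Fin m → 𝔄) :
    colInner (starMul R y) u = colInner y (fun k => ∑ j, R k j * u j) := by
  simp only [colInner, starMul, LinearMap.coe_mk, AddHom.coe_mk, sum_inner, inner_sum]
  rw [Finset.sum_comm]
  refine Finset.sum_congr rfl fun k _ => Finset.sum_congr rfl fun i _ => ?_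
  rw [inner_mul_left_eq, conj_conj]

/-- With `L y = R* y`, this says that `L L*` is the action of the Gram matrix, so that its
determinant gives the Jacobian. With a single column only the products `conj x * (x * u)` occur. -/
lemma starMul_mul (hassoc : (∀ a b c : 𝔄, (a * b) * c = a * (b * c)) ∨ m ≤ 1)
    (R : Matrix (Fin n) (Fin m) 𝔄) (u : Fin m → 𝔄) :
    starMul R (fun k => ∑ j, R k j * u j) = leftMul (starMulSelf R) u := by
  funext i
  simp only [starMul, LinearMap.coe_mk, AddHom.coe_mk, leftMul_apply, starMulSelf, Matrix.of_apply,
    alg_sum_mul, alg_mul_sum]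
  rw [Finset.sum_comm]
  refine Finset.sum_congr rfl fun j _ => Finset.sum_congr rfl fun k _ => ?_
  rcases hassoc with hassoc | hm
  · rw [hassoc]
  · have : i = j := by
      have := i.2
      have := j.2
      apply Fin.ext
      omega
    subst this
    rw [conj_mul_mul, conj_mul_self, smul_one_mul]

end Gram

end HermitianMatrices

/-! ### Continuity and measurability of the matrix functions -/

section Measurability

set_option linter.unusedSectionVars false

variable {𝔄 : Type*} [NormedAddCommGroup 𝔄] [InnerProductSpace ℝ 𝔄]

instance instBorelSpaceMatrix {ι κ : Type*} [Finite ι] [Finite κ] {α : Type*} [TopologicalSpace α]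
    [MeasurableSpace α] [BorelSpace α] [SecondCountableTopology α] : BorelSpace (Matrix ι κ α) :=
  inferInstanceAs (BorelSpace (ι → κ → α))

instance instSecondCountableTopologyMatrix {ι κ : Type*} [Finite ι] [Finite κ] {α : Type*}
    [TopologicalSpace α] [SecondCountableTopology α] : SecondCountableTopology (Matrix ι κ α) :=
  inferInstanceAs (SecondCountableTopology (ι → κ → α))

variable [Mul 𝔄] [One 𝔄]

lemma continuous_conj : Continuous (conj : 𝔄 → 𝔄) := by
  unfold conj rePart
  fun_prop

variable [RealNormedDivisionAlgebra 𝔄]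

lemma norm_alg_mul (x y : 𝔄) : ‖x * y‖ = ‖x‖ * ‖y‖ := by
  rw [← sq_eq_sq₀ (norm_nonneg _) (by positivity), mul_pow, ← real_inner_self_eq_norm_sq,
    ← real_inner_self_eq_norm_sq, ← real_inner_self_eq_norm_sq,
    RealNormedDivisionAlgebra.inner_mul_self]

instance instContinuousMul : ContinuousMul 𝔄 where
  continuous_mul := by
    have h : IsBoundedBilinearMap ℝ (fun p : 𝔄 × 𝔄 => p.1 * p.2) :=
      { add_left := RealNormedDivisionAlgebra.add_mul
        smul_left := RealNormedDivisionAlgebra.smul_mul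
        add_right := RealNormedDivisionAlgebra.mul_add
        smul_right := RealNormedDivisionAlgebra.mul_smul
        bound := ⟨1, one_pos, fun x y => by rw [norm_alg_mul, _root_.one_mul]⟩ }
    exact h.continuous

lemma continuous_leftMul {m : ℕ} :
    Continuous fun p : Matrix (Fin m) (Fin m) 𝔄 × (Fin m → 𝔄) => leftMul p.1 p.2 := by
  refine continuous_pi fun i => ?_
  simp only [leftMul_apply]
  fun_prop

lemma continuous_starMulSelf {n m : ℕ} :
    Continuous (starMulSelf : Matrix (Fin n) (Fin m) 𝔄 → Matrix (Fin m) (Fin m) 𝔄) := by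
  refine continuous_matrix fun i j => ?_
  simp only [starMulSelf, Matrix.of_apply]
  have := continuous_conj (𝔄 := 𝔄)
  fun_prop

lemma continuous_border {m : ℕ} :
    Continuous fun p : Matrix (Fin m) (Fin m) 𝔄 × (Fin m → 𝔄) × ℝ => border p.1 p.2.1 p.2.2 := by
  have := continuous_conj (𝔄 := 𝔄)
  refine continuous_matrix fun i j => ?_
  induction i using Fin.lastCases <;> induction j using Fin.lastCases <;> simp <;> fun_prop

lemma isClosed_isHermitian {m : ℕ} : IsClosed {A : Matrix (Fin m) (Fin m) 𝔄 | IsHermitian A} := by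
  have := continuous_conj (𝔄 := 𝔄)
  simp only [IsHermitian, ofPred_forall]
  refine isClosed_iInter fun i => isClosed_iInter fun j => isClosed_eq ?_ ?_ <;> fun_prop

variable [FiniteDimensional ℝ 𝔄]

/-- Positivity at each point of the compact unit sphere persists under small perturbations of `A`,
uniformly on the sphere. -/
lemma isOpen_forall_pos {m : ℕ} :
    IsOpen {A : Matrix (Fin m) (Fin m) 𝔄 |
      ∀ v ∈ Metric.sphere (0 : Fin m → 𝔄) 1, 0 < colInner v (leftMul A v)} := by
  rw [isOpen_iff_eventually]
  intro A hA
  refine (isCompact_sphere _ _).eventually_forall_of_forall_eventually fun v hv => ?_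
  have hcont : Continuous fun p : Matrix (Fin m) (Fin m) 𝔄 × (Fin m → 𝔄) =>
      colInner p.2 (leftMul p.1 p.2) := by
    have h := continuous_leftMul (𝔄 := 𝔄) (m := m)
    unfold colInner
    refine continuous_finsetSum _ fun i _ => Continuous.inner ?_ ?_
    · fun_prop
    · exact (continuous_apply i).comp h
  exact hcont.continuousAt.eventually (lt_mem_nhds (hA v hv))

lemma isPosDef_iff_sphere {m : ℕ} {A : Matrix (Fin m) (Fin m) 𝔄} :
    IsPosDef A ↔ IsHermitian A ∧
      ∀ v ∈ Metric.sphere (0 : Fin m → 𝔄) 1, 0 < colInner v (leftMul A v) := by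
  rw [isPosDef_iff]
  refine and_congr_right fun _ => ⟨fun h v hv => h v ?_, fun h v hv => ?_⟩
  · rintro rfl
    simp at hv
  · have hv' : ‖v‖ ≠ 0 := norm_ne_zero_iff.2 hv
    have h1 := h (‖v‖⁻¹ • v) (by simp [norm_smul, hv'])
    have h2 : colInner (‖v‖⁻¹ • v) (leftMul A (‖v‖⁻¹ • v)) =
        ‖v‖⁻¹ ^ 2 * colInner v (leftMul A v) := by
      simp only [map_smul, colInner, Pi.smul_apply, inner_smul_left, inner_smul_right,
        Finset.mul_sum, RCLike.conj_to_real]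
      exact Finset.sum_congr rfl fun _ _ => by ring
    rw [h2] at h1
    exact pos_of_mul_pos_right h1 (by positivity)

variable [MeasurableSpace 𝔄] [BorelSpace 𝔄]

lemma measurableSet_isPosDef {m : ℕ} :
    MeasurableSet {A : Matrix (Fin m) (Fin m) 𝔄 | IsPosDef A} := by
  simp only [isPosDef_iff_sphere, ofPred_and]
  exact isClosed_isHermitian.measurableSet.inter isOpen_forall_pos.measurableSet

lemma measurableSet_unitCone {m : ℕ} : MeasurableSet (unitCone 𝔄 m) := by
  refine measurableSet_isPosDef.inter (measurableSet_isPosDef.preimage ?_)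
  exact (continuous_const.sub continuous_id).measurable

lemma continuous_toMatrix_leftMul {m : ℕ} {ι : Type*} [Fintype ι] [DecidableEq ι]
    (b : Basis ι ℝ (Fin m → 𝔄)) :
    Continuous fun A : Matrix (Fin m) (Fin m) 𝔄 => LinearMap.toMatrix b b (leftMul A) := by
  refine continuous_matrix fun i j => ?_
  simp only [LinearMap.toMatrix_apply]
  have h1 : Continuous fun A : Matrix (Fin m) (Fin m) 𝔄 => leftMul A (b j) :=
    continuous_leftMul.comp (by fun_prop : Continuous fun A => (A, b j))
  exact (LinearMap.continuous_of_finiteDimensional (b.coord i)).comp h1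

lemma measurable_detPos {m : ℕ} :
    Measurable (detPos : Matrix (Fin m) (Fin m) 𝔄 → ℝ) := by
  have h : Continuous fun A : Matrix (Fin m) (Fin m) 𝔄 => LinearMap.det (leftMul A) := by
    let b := Module.finBasis ℝ (Fin m → 𝔄)
    simp_rw [← LinearMap.det_toMatrix b]
    exact (continuous_toMatrix_leftMul b).matrix_det
  exact h.measurable.pow_const _

lemma measurable_highestWeight {m : ℕ} (κ : Fin m → ℝ) :
    Measurable (highestWeight κ : Matrix (Fin m) (Fin m) 𝔄 → ℝ) := by
  unfold highestWeight
  refine Finset.measurable_prod _ fun i _ => Measurable.pow_const (measurable_detPos.comp ?_) _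
  refine Continuous.measurable (continuous_matrix fun a b => ?_)
  simp only [leadingBlock, Matrix.submatrix_apply]
  fun_prop

lemma measurable_matInv {m : ℕ} :
    Measurable (matInv : Matrix (Fin m) (Fin m) 𝔄 → Matrix (Fin m) (Fin m) 𝔄) := by
  let b := Module.finBasis ℝ (Fin m → 𝔄)
  let e := LinearMap.toMatrixAlgEquiv b
  have hM : Continuous fun A : Matrix (Fin m) (Fin m) 𝔄 => e (leftMul A) :=
    continuous_toMatrix_leftMul b
  -- Cramer's rule. It also covers singular maps: `Ring.inverse` is then 0, and so is the inverse of
  -- the zero determinant.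
  have hinv : ∀ A : Matrix (Fin m) (Fin m) 𝔄,
      (Ring.inverse (leftMul A : Module.End ℝ (Fin m → 𝔄))) =
        ((e (leftMul A)).det)⁻¹ • e.symm (e (leftMul A)).adjugate := by
    intro A
    rw [← map_smul, ← Ring.inverse_eq_inv', ← Matrix.inv_def, Matrix.nonsing_inv_eq_ringInverse]
    by_cases hu : IsUnit (leftMul A : Module.End ℝ (Fin m → 𝔄))
    · obtain ⟨u, hu⟩ := hu
      have hmap : e (leftMul A) = ↑(Units.map e.toRingEquiv.toMulEquiv.toMonoidHom u) := by
        rw [← hu]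
        rfl
      rw [hmap, Ring.inverse_unit, ← map_inv, Units.coe_map, ← hu, Ring.inverse_unit]
      exact (e.symm_apply_apply _).symm
    · rw [Ring.inverse_non_unit _ hu, Ring.inverse_non_unit _ (by rwa [MulEquiv.isUnit_map]), map_zero]
  have hadj : Continuous fun A : Matrix (Fin m) (Fin m) 𝔄 => (e (leftMul A)).adjugate :=
    hM.matrix_adjugate
  refine measurable_pi_lambda _ fun i => measurable_pi_lambda _ fun j => ?_
  simp only [matInv, Matrix.of_apply, hinv]
  have h1 : Continuous fun M : Matrix (Fin (finrank ℝ (Fin m → 𝔄))) (Fin (finrank ℝ (Fin m → 𝔄))) ℝ =>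
      (e.symm M) (Pi.single j 1) i :=
    LinearMap.continuous_of_finiteDimensional
      (LinearMap.proj i ∘ₗ LinearMap.applyₗ (Pi.single j (1 : 𝔄)) ∘ₗ e.symm.toLinearMap)
  exact (hM.matrix_det.measurable.inv).smul (h1.comp hadj).measurable

end Measurability

/-- Tonelli, regrouping (old diagonal, corner), (old upper entries, last column) as coordinates of
the leading block followed by the border. -/
lemma lintegral_prod_rearrange {D U W X : Type*} [MeasurableSpace D] [MeasurableSpace U]
    [MeasurableSpace W] [MeasurableSpace X] {μD : Measure D} {μU : Measure U} {μW : Measure W}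
    {μX : Measure X} [SFinite μD] [SFinite μU] [SFinite μW] [SFinite μX]
    {g : (D × U) × W × X → ENNReal} (hg : Measurable g) :
    ∫⁻ p : (D × X) × U × W, g ((p.1.1, p.2.1), p.2.2, p.1.2) ∂((μD.prod μX).prod (μU.prod μW)) =
      ∫⁻ q, (∫⁻ r, g (q, r) ∂(μW.prod μX)) ∂(μD.prod μU) := by
  rw [lintegral_prod _ (by fun_prop), lintegral_prod _ (by fun_prop), lintegral_prod _ (by fun_prop)]
  refine lintegral_congr fun d => ?_
  rw [lintegral_lintegral_swap (by fun_prop), lintegral_prod _ (by fun_prop)]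
  refine lintegral_congr fun u => ?_
  rw [lintegral_prod _ (by fun_prop)]

/-! ### Lebesgue measure when a matrix grows by a column or by a border -/

section Coordinates

set_option linter.unusedSectionVars false

variable {𝔄 : Type*} [NormedAddCommGroup 𝔄] [InnerProductSpace ℝ 𝔄] [FiniteDimensional ℝ 𝔄]
  [MeasurableSpace 𝔄] [BorelSpace 𝔄]

variable (𝔄) in
/-- Appending a last column to a matrix preserves Lebesgue measure. -/
lemma measurePreserving_snoc_column (n m : ℕ) :
    MeasurePreserving (fun p : Matrix (Fin n) (Fin m) 𝔄 × (Fin n → 𝔄) =>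
      (Matrix.of fun k => (Fin.snoc (α := fun _ => 𝔄) (p.1 k) (p.2 k) : Fin (m + 1) → 𝔄)))
      ((lebesgueMat 𝔄 n m).prod volume) (lebesgueMat 𝔄 n (m + 1)) := by
  have h1 := (measurePreserving_arrowProdEquivProdArrow 𝔄 (Fin m → 𝔄) (Fin n)
    (fun _ => volume) (fun _ => Measure.pi fun _ => volume)).symm
  have h2 := measurePreserving_pi (fun _ : Fin n => (volume : Measure 𝔄).prod
      (Measure.pi fun _ : Fin m => (volume : Measure 𝔄)))
    (fun _ : Fin n => Measure.pi fun _ : Fin (m + 1) => (volume : Measure 𝔄))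
    (fun _ => (measurePreserving_piFinSuccAbove (fun _ : Fin (m + 1) => (volume : Measure 𝔄))
      (Fin.last m)).symm)
  have h3 := (h2.comp h1).comp (Measure.measurePreserving_swap
    (μ := Measure.pi fun _ : Fin n => Measure.pi fun _ : Fin m => (volume : Measure 𝔄))
    (ν := Measure.pi fun _ : Fin n => (volume : Measure 𝔄)))
  have h4 : (fun p : (Fin n → Fin m → 𝔄) × (Fin n → 𝔄) =>
      fun k => (Fin.snoc (α := fun _ => 𝔄) (p.1 k) (p.2 k) : Fin (m + 1) → 𝔄)) =
      ((fun a i => (MeasurableEquiv.piFinSuccAbove (fun _ => 𝔄) (Fin.last m)).symm (a i)) ∘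
        (MeasurableEquiv.arrowProdEquivProdArrow 𝔄 (Fin m → 𝔄) (Fin n)).symm) ∘ Prod.swap := by
    funext p k
    change _ = Fin.insertNth (α := fun _ => 𝔄) (Fin.last m) (p.2 k) (p.1 k)
    rw [Fin.insertNth_last']
  rw [← h4] at h3
  exact h3

variable [Mul 𝔄] [One 𝔄]

lemma measurable_hermOfCoords {m : ℕ} :
    Measurable (hermOfCoords (𝔄 := 𝔄) (m := m)) := by
  refine Continuous.measurable (continuous_matrix fun i j => ?_)
  have := continuous_conj (𝔄 := 𝔄)
  simp only [hermOfCoords, Matrix.of_apply]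
  split_ifs <;> fun_prop

variable (𝔄) in
instance instSFiniteLebesgueHerm (m : ℕ) : SFinite (lebesgueHerm 𝔄 m) := by
  unfold lebesgueHerm
  infer_instance

/-- The position of an entry above the diagonal of a matrix of size `m + 1`: it is either above
the diagonal of the leading block of size `m`, or in the last column. -/
def upperSum (m : ℕ) : {p : Fin m × Fin m // p.1 < p.2} ⊕ Fin m →
    {p : Fin (m + 1) × Fin (m + 1) // p.1 < p.2}
  | Sum.inl p => ⟨(p.1.1.castSucc, p.1.2.castSucc), Fin.castSucc_lt_castSucc_iff.2 p.2⟩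
  | Sum.inr i => ⟨(i.castSucc, Fin.last m), Fin.castSucc_lt_last i⟩

lemma upperSum_bijective (m : ℕ) : Function.Bijective (upperSum m) := by
  constructor
  · rintro (⟨⟨i, j⟩, hij⟩ | i) (⟨⟨k, l⟩, hkl⟩ | k) h
    · simpa [upperSum] using h
    · have := congrArg (fun p => p.1.2) h
      simp [upperSum, Fin.castSucc_ne_last] at this
    · have := congrArg (fun p => p.1.2) h
      simp [upperSum, (Fin.castSucc_ne_last _).symm] at this
    · simpa [upperSum] using h
  · rintro ⟨⟨i, j⟩, hij⟩
    induction j using Fin.lastCases with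
    | last =>
      induction i using Fin.lastCases with
      | last => exact absurd hij (lt_irrefl _)
      | cast i => exact ⟨Sum.inr i, rfl⟩
    | cast j =>
      induction i using Fin.lastCases with
      | last => exact absurd hij (not_lt_of_gt (Fin.castSucc_lt_last j))
      | cast i => exact ⟨Sum.inl ⟨(i, j), Fin.castSucc_lt_castSucc_iff.1 hij⟩, rfl⟩

/-- `upperSum` as an equivalence. -/
noncomputable def upperEquiv (m : ℕ) : {p : Fin m × Fin m // p.1 < p.2} ⊕ Fin m ≃
    {p : Fin (m + 1) × Fin (m + 1) // p.1 < p.2} :=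
  Equiv.ofBijective (upperSum m) (upperSum_bijective m)

lemma measurePreserving_upper (m : ℕ) :
    MeasurePreserving
      (fun p : ({p : Fin m × Fin m // p.1 < p.2} → 𝔄) × (Fin m → 𝔄) =>
        MeasurableEquiv.piCongrLeft (fun _ => 𝔄) (upperEquiv m)
          ((MeasurableEquiv.sumPiEquivProdPi fun _ => 𝔄).symm p))
      ((Measure.pi fun _ => volume).prod (Measure.pi fun _ => volume))
      (Measure.pi fun _ => volume) :=
  (measurePreserving_piCongrLeft (fun _ => (volume : Measure 𝔄)) (upperEquiv m)).comp
    (measurePreserving_sumPiEquivProdPi_symm fun _ => (volume : Measure 𝔄))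

lemma measurePreserving_snoc_real (m : ℕ) :
    MeasurePreserving (fun p : (Fin m → ℝ) × ℝ => (Fin.snoc (α := fun _ => ℝ) p.1 p.2 : Fin (m + 1) → ℝ))
      ((volume : Measure (Fin m → ℝ)).prod volume) volume := by
  have h := (measurePreserving_piFinSuccAbove (fun _ : Fin (m + 1) => (volume : Measure ℝ))
    (Fin.last m)).symm.comp (Measure.measurePreserving_swap
    (μ := (volume : Measure (Fin m → ℝ))) (ν := (volume : Measure ℝ)))
  have h2 : (fun p : (Fin m → ℝ) × ℝ => (Fin.snoc (α := fun _ => ℝ) p.1 p.2 : Fin (m + 1) → ℝ)) =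
      (MeasurableEquiv.piFinSuccAbove (fun _ => ℝ) (Fin.last m)).symm ∘ Prod.swap := by
    funext p
    change _ = Fin.insertNth (α := fun _ => ℝ) (Fin.last m) p.2 p.1
    rw [Fin.insertNth_last']
  rw [h2]
  exact h

lemma hermOfCoords_snoc {m : ℕ} (d : Fin m → ℝ) (a : ℝ)
    (u : {p : Fin m × Fin m // p.1 < p.2} → 𝔄) (w : Fin m → 𝔄) :
    hermOfCoords (Fin.snoc (α := fun _ => ℝ) d a,
      MeasurableEquiv.piCongrLeft (fun _ => 𝔄) (upperEquiv m)
        ((MeasurableEquiv.sumPiEquivProdPi fun _ => 𝔄).symm (u, w))) =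
      border (hermOfCoords (d, u)) w a := by
  have hinl : ∀ (i j : Fin m) (hij : i < j) h,
      MeasurableEquiv.piCongrLeft (fun _ => 𝔄) (upperEquiv m)
        ((MeasurableEquiv.sumPiEquivProdPi fun _ => 𝔄).symm (u, w))
          ⟨(i.castSucc, j.castSucc), h⟩ = u ⟨(i, j), hij⟩ := fun i j hij h =>
    MeasurableEquiv.piCongrLeft_apply_apply (upperEquiv m) (β := fun _ => 𝔄)
      ((MeasurableEquiv.sumPiEquivProdPi fun _ => 𝔄).symm (u, w)) (Sum.inl ⟨(i, j), hij⟩)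
  have hinr : ∀ (i : Fin m) h,
      MeasurableEquiv.piCongrLeft (fun _ => 𝔄) (upperEquiv m)
        ((MeasurableEquiv.sumPiEquivProdPi fun _ => 𝔄).symm (u, w))
          ⟨(i.castSucc, Fin.last m), h⟩ = w i := fun i h =>
    MeasurableEquiv.piCongrLeft_apply_apply (upperEquiv m) (β := fun _ => 𝔄)
      ((MeasurableEquiv.sumPiEquivProdPi fun _ => 𝔄).symm (u, w)) (Sum.inr i)
  ext i j
  induction i using Fin.lastCases with
  | last =>
    induction j using Fin.lastCases with
    | last => simp [hermOfCoords]
    | cast j => simp [hermOfCoords, hinr, Fin.castSucc_lt_last, not_lt_of_gt (Fin.castSucc_lt_last j)]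
  | cast i =>
    induction j using Fin.lastCases with
    | last => simp [hermOfCoords, hinr, Fin.castSucc_lt_last]
    | cast j =>
      rw [border_castSucc_castSucc]
      simp only [hermOfCoords, Matrix.of_apply, Fin.castSucc_lt_castSucc_iff, Fin.snoc_castSucc]
      split_ifs with h1 h2
      · rw [hinl _ _ h1]
      · rw [hinl _ _ h2]
      · rfl

variable [RealNormedDivisionAlgebra 𝔄]

lemma lintegral_lebesgueMat_succ {n m : ℕ} {f : Matrix (Fin n) (Fin (m + 1)) 𝔄 → ENNReal}
    (hf : Measurable f) :
    ∫⁻ R, f R ∂(lebesgueMat 𝔄 n (m + 1)) =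
      ∫⁻ R, (∫⁻ y : Fin n → 𝔄,
        f (Matrix.of fun k => (Fin.snoc (α := fun _ => 𝔄) (R k) (y k) : Fin (m + 1) → 𝔄)))
        ∂(lebesgueMat 𝔄 n m) := by
  have h := measurePreserving_snoc_column 𝔄 n m
  have : SFinite (lebesgueMat 𝔄 n m) :=
    inferInstanceAs (SFinite (Measure.pi fun _ : Fin n => Measure.pi fun _ : Fin m =>
      (volume : Measure 𝔄)))
  rw [← h.lintegral_comp hf, lintegral_prod]
  exact (hf.comp h.measurable).aemeasurable

lemma lintegral_lebesgueHerm_succ {m : ℕ}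
    {f : Matrix (Fin (m + 1)) (Fin (m + 1)) 𝔄 → ENNReal} (hf : Measurable f) :
    ∫⁻ B, f B ∂(lebesgueHerm 𝔄 (m + 1)) =
      ∫⁻ A, (∫⁻ w : Fin m → 𝔄, ∫⁻ a : ℝ, f (border A w a)) ∂(lebesgueHerm 𝔄 m) := by
  have hmp := (measurePreserving_snoc_real m).prod (measurePreserving_upper (𝔄 := 𝔄) m)
  have hb : Measurable fun p : Matrix (Fin m) (Fin m) 𝔄 × (Fin m → 𝔄) × ℝ =>
      border p.1 p.2.1 p.2.2 := continuous_border.measurable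
  have hrhs : ∀ A : Matrix (Fin m) (Fin m) 𝔄,
      ∫⁻ w : Fin m → 𝔄, ∫⁻ a : ℝ, f (border A w a) =
        ∫⁻ q : (Fin m → 𝔄) × ℝ, f (border A q.1 q.2) := by
    intro A
    rw [Measure.volume_eq_prod, lintegral_prod]
    exact (hf.comp (hb.comp measurable_prodMk_left)).aemeasurable
  simp_rw [hrhs]
  have hmeas : Measurable fun A : Matrix (Fin m) (Fin m) 𝔄 =>
      ∫⁻ q : (Fin m → 𝔄) × ℝ, f (border A q.1 q.2) :=
    (hf.comp hb).lintegral_prod_right'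
  rw [lebesgueHerm, lintegral_map hf measurable_hermOfCoords, lebesgueHerm,
    lintegral_map hmeas measurable_hermOfCoords, 
    ← hmp.lintegral_comp (f := fun c => f (hermOfCoords c)) (hf.comp measurable_hermOfCoords)]
  have hh := measurable_hermOfCoords (𝔄 := 𝔄) (m := m)
  have hB : Measurable fun q : ((Fin m → ℝ) × ({p : Fin m × Fin m // p.1 < p.2} → 𝔄)) ×
      (Fin m → 𝔄) × ℝ => f (border (hermOfCoords q.1) q.2.1 q.2.2) :=
    hf.comp (hb.comp ((hh.comp measurable_fst).prodMk measurable_snd))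
  have h := lintegral_prod_rearrange (μD := (volume : Measure (Fin m → ℝ)))
    (μU := Measure.pi fun _ : {p : Fin m × Fin m // p.1 < p.2} => (volume : Measure 𝔄))
    (μW := (volume : Measure (Fin m → 𝔄))) (μX := (volume : Measure ℝ)) hB
  refine Eq.trans (lintegral_congr fun p => ?_) h
  rcases p with ⟨⟨d, a⟩, u, w⟩
  exact congrArg f (hermOfCoords_snoc d a u w)

end Coordinates

/-! ### Image of Lebesgue measure under the Gram map, up to a constant -/

section Wishart

set_option linter.unusedSectionVars false

variable {𝔄 : Type*} [NormedAddCommGroup 𝔄] [InnerProductSpace ℝ 𝔄] [FiniteDimensional ℝ 𝔄]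
  [MeasurableSpace 𝔄] [BorelSpace 𝔄]

variable (𝔄) in
/-- The product Lebesgue measure and the Euclidean Lebesgue measure on columns are proportional. -/
lemma exists_lintegral_column_eq (n : ℕ) :
    ∃ c : ENNReal, ∀ g : (Fin n → 𝔄) → ENNReal, Measurable g →
      ∫⁻ y, g y = c * ∫⁻ z : PiLp 2 (fun _ : Fin n => 𝔄), g (WithLp.ofLp z) := by
  let e := PiLp.continuousLinearEquiv 2 ℝ (fun _ : Fin n => 𝔄)
  have : ((volume : Measure (PiLp 2 (fun _ : Fin n => 𝔄))).map e).IsAddHaarMeasure :=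
    e.isAddHaarMeasure_map _
  obtain ⟨c, hc⟩ : ∃ c : NNReal, (volume : Measure (Fin n → 𝔄)) =
      c • (volume : Measure (PiLp 2 (fun _ : Fin n => 𝔄))).map e :=
    ⟨_, Measure.isAddLeftInvariant_eq_smul _ _⟩
  refine ⟨c, fun g hg => ?_⟩
  conv_lhs => rw [hc]
  rw [lintegral_smul_measure, lintegral_map hg e.continuous.measurable]
  rfl

variable (𝔄) in
-- Uniqueness of Haar measure, as in `exists_lintegral_column_eq` but in the other direction, so
-- that no constant has to be inverted. The values do not matter: a Gaussian integral fixes the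
-- total constant at the end.
lemma exists_lintegral_euclidean_eq (n : ℕ) :
    ∃ c : ENNReal, ∀ g : (Fin n → 𝔄) → ENNReal, Measurable g →
      ∫⁻ z : PiLp 2 (fun _ : Fin n => 𝔄), g (WithLp.ofLp z) = c * ∫⁻ y, g y := by
  let e := (PiLp.continuousLinearEquiv 2 ℝ (fun _ : Fin n => 𝔄)).symm
  have : ((volume : Measure (Fin n → 𝔄)).map e).IsAddHaarMeasure := e.isAddHaarMeasure_map _
  obtain ⟨c, hc⟩ : ∃ c : NNReal, (volume : Measure (PiLp 2 (fun _ : Fin n => 𝔄))) =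
      c • (volume : Measure (Fin n → 𝔄)).map e :=
    ⟨_, Measure.isAddLeftInvariant_eq_smul _ _⟩
  have hofLp : Measurable fun z : PiLp 2 (fun _ : Fin n => 𝔄) => WithLp.ofLp z :=
    (PiLp.continuous_ofLp 2 _).measurable
  refine ⟨c, fun g hg => ?_⟩
  conv_lhs => rw [hc]
  rw [lintegral_smul_measure, lintegral_map (f := fun z : PiLp 2 (fun _ : Fin n => 𝔄) => g (WithLp.ofLp z))
    (hg.comp hofLp) e.continuous.measurable]
  rfl

variable [Mul 𝔄] [One 𝔄] [RealNormedDivisionAlgebra 𝔄]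

/-- The extension by zero of the function `|B| ^ p * f B` on positive definite matrices. -/
noncomputable def coneWeight {m : ℕ} (p : ℝ) (f : Matrix (Fin m) (Fin m) 𝔄 → ENNReal) :
    Matrix (Fin m) (Fin m) 𝔄 → ENNReal :=
  {B | IsPosDef B}.indicator fun B => ENNReal.ofReal (detPos B ^ p) * f B

lemma coneWeight_of_isPosDef {m : ℕ} (p : ℝ) (f : Matrix (Fin m) (Fin m) 𝔄 → ENNReal)
    {B : Matrix (Fin m) (Fin m) 𝔄} (hB : IsPosDef B) :
    coneWeight p f B = ENNReal.ofReal (detPos B ^ p) * f B :=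
  indicator_of_mem (s := {B : Matrix (Fin m) (Fin m) 𝔄 | IsPosDef B}) hB _

lemma coneWeight_of_not_isPosDef {m : ℕ} (p : ℝ) (f : Matrix (Fin m) (Fin m) 𝔄 → ENNReal)
    {B : Matrix (Fin m) (Fin m) 𝔄} (hB : ¬ IsPosDef B) : coneWeight p f B = 0 :=
  indicator_of_notMem (s := {B : Matrix (Fin m) (Fin m) 𝔄 | IsPosDef B}) hB _

lemma measurable_coneWeight {m : ℕ} (p : ℝ) {f : Matrix (Fin m) (Fin m) 𝔄 → ENNReal}
    (hf : Measurable f) : Measurable (coneWeight p f) :=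
  ((measurable_detPos.pow_const p).ennreal_ofReal.mul hf).indicator measurableSet_isPosDef

lemma measurable_starMulSelf {n m : ℕ} :
    Measurable (starMulSelf : Matrix (Fin n) (Fin m) 𝔄 → Matrix (Fin m) (Fin m) 𝔄) :=
  continuous_starMulSelf.measurable

set_option maxHeartbeats 1000000 in
variable (𝔄) in
/-- Integration over the last column of a matrix whose other columns are fixed. -/
lemma exists_lintegral_last_column {n m : ℕ} (hmn : m < n)
    (hassoc : (∀ a b c : 𝔄, (a * b) * c = a * (b * c)) ∨ m ≤ 1) :
    ∃ C : ENNReal, ∀ f : Matrix (Fin (m + 1)) (Fin (m + 1)) 𝔄 → ENNReal, Measurable f →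
      ∀ R : Matrix (Fin n) (Fin m) 𝔄, IsPosDef (starMulSelf R) →
        ∫⁻ y : Fin n → 𝔄, f (border (starMulSelf R) (starMul R y) (colInner y y)) =
          C * (ENNReal.ofReal (detPos (starMulSelf R) ^ (-(((n : ℝ) - m + 1) * algDim 𝔄 / 2 - 1))) *
            ∫⁻ w : Fin m → 𝔄, ∫⁻ a : ℝ,
              coneWeight (((n : ℝ) - m) * algDim 𝔄 / 2 - 1) f (border (starMulSelf R) w a)) := by
  obtain ⟨c₁, hc₁⟩ := exists_lintegral_column_eq 𝔄 n
  obtain ⟨c₂, hc₂⟩ := exists_lintegral_euclidean_eq 𝔄 m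
  -- The real dimension of the kernel of `y ↦ R* y`, positive because `m < n`.
  let d := (n - m) * finrank ℝ 𝔄
  have hd : 0 < d := Nat.mul_pos (Nat.sub_pos_of_lt hmn) (finrank_alg_pos 𝔄)
  have hdr : (d : ℝ) / 2 - 1 = ((n : ℝ) - m) * algDim 𝔄 / 2 - 1 := by
    simp only [d, Nat.cast_mul, Nat.cast_sub hmn.le, algDim]
  refine ⟨c₁ * radialConst d * c₂, fun f hf R hR => ?_⟩
  obtain ⟨N, hN⟩ := exists_leftMul_inverse hR
  set A := starMulSelf R
  let en := (WithLp.linearEquiv 2 ℝ (Fin n → 𝔄)).symm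
  let em := (WithLp.linearEquiv 2 ℝ (Fin m → 𝔄)).symm
  let L : PiLp 2 (fun _ : Fin n => 𝔄) →ₗ[ℝ] PiLp 2 (fun _ : Fin m => 𝔄) :=
    em.toLinearMap ∘ₗ starMul R ∘ₗ en.symm.toLinearMap
  let N' : PiLp 2 (fun _ : Fin m => 𝔄) →ₗ[ℝ] PiLp 2 (fun _ : Fin m => 𝔄) :=
    em.toLinearMap ∘ₗ N ∘ₗ em.symm.toLinearMap
  have hadj : ∀ u, LinearMap.adjoint L u = en (fun k => ∑ j, R k j * em.symm u j) := by
    intro u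
    refine ext_inner_left ℝ fun y => ?_
    rw [LinearMap.adjoint_inner_right]
    exact (colInner_eq_inner _ _).symm.trans
      ((colInner_starMul R _ _).trans (colInner_eq_inner _ _))
  have hLL : L ∘ₗ LinearMap.adjoint L = em.toLinearMap ∘ₗ leftMul A ∘ₗ em.symm.toLinearMap := by
    refine LinearMap.ext fun u => ?_
    rw [LinearMap.comp_apply, hadj]
    exact congrArg em (starMul_mul hassoc R _)
  have hdet : LinearMap.det (L ∘ₗ LinearMap.adjoint L) = LinearMap.det (leftMul A) := by
    rw [hLL]
    exact LinearMap.det_conj _ em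
  have hLN : ∀ w, L (LinearMap.adjoint L (N' w)) = w := by
    intro w
    have h := LinearMap.congr_fun hLL (N' w)
    refine h.trans ?_
    exact congrArg em (LinearMap.congr_fun hN (em.symm w))
  have hfin : finrank ℝ (PiLp 2 (fun _ : Fin n => 𝔄)) =
      finrank ℝ (PiLp 2 (fun _ : Fin m => 𝔄)) + d := by
    rw [← en.finrank_eq, ← em.finrank_eq, finrank_pi_fintype, finrank_pi_fintype]
    simp only [Finset.sum_const, Finset.card_univ, Fintype.card_fin, smul_eq_mul, d]
    rw [← add_mul, Nat.add_sub_cancel' hmn.le]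
  have hb : Measurable fun p : Matrix (Fin m) (Fin m) 𝔄 × (Fin m → 𝔄) × ℝ =>
      border p.1 p.2.1 p.2.2 := continuous_border.measurable
  have hbA : Measurable fun p : (Fin m → 𝔄) × ℝ => border A p.1 p.2 :=
    hb.comp measurable_prodMk_left
  have hofLp : Measurable fun z : PiLp 2 (fun _ : Fin m => 𝔄) => WithLp.ofLp z :=
    (PiLp.continuous_ofLp 2 _).measurable
  have hmain := lintegral_linear_norm_sq L N' hLN (by rw [hdet]; exact det_leftMul_pos hR) hd hfin
    (g := fun p => f (border A (WithLp.ofLp p.1) p.2))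
    (hf.comp (hbA.comp ((hofLp.comp measurable_fst).prodMk measurable_snd)))
  -- With `p' = (n-m)β/2 - 1` and `p = p' + β/2`, the Jacobian is `|A|^(-β/2) = |A|^(-p) |A|^p'`,
  -- and `|A|^p'` combines with the power of the Schur complement into the `p'`-th power of the
  -- bordered determinant.
  have hinner : ∀ w : Fin m → 𝔄,
      ENNReal.ofReal (LinearMap.det (leftMul A) ^ (-(1 / 2) : ℝ)) *
        ∫⁻ a in Ioi (colInner w (N w)), ENNReal.ofReal ((a - colInner w (N w)) ^ ((d : ℝ) / 2 - 1)) *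
          f (border A w a) =
      ENNReal.ofReal (detPos A ^ (-(((n : ℝ) - m + 1) * algDim 𝔄 / 2 - 1))) *
        ∫⁻ a : ℝ, coneWeight (((n : ℝ) - m) * algDim 𝔄 / 2 - 1) f (border A w a) := by
    intro w
    rw [← lintegral_indicator measurableSet_Ioi, ← lintegral_const_mul' _ _ ENNReal.ofReal_ne_top,
      ← lintegral_const_mul' _ _ ENNReal.ofReal_ne_top]
    refine lintegral_congr fun a => ?_
    by_cases ha : colInner w (N w) < a
    · have hpd : IsPosDef (border A w a) := (isPosDef_border_iff hassoc hR hN w a).2 ha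
      have hdpos := detPos_pos hR
      have hdetpos := det_leftMul_pos hR
      have ha' : 0 < a - colInner w (N w) := sub_pos.2 ha
      rw [indicator_of_mem (mem_Ioi.2 ha), coneWeight_of_isPosDef _ _ hpd,
        ← mul_assoc, ← mul_assoc, ← ENNReal.ofReal_mul (by positivity),
        ← ENNReal.ofReal_mul (by positivity), detPos_border hassoc hR hN ha, hdr,
        detPos_rpow_algDim hR, Real.mul_rpow hdpos.le ha'.le, ← mul_assoc,
        ← Real.rpow_add hdpos]
      congr 4
      ring
    · have hpd : ¬ IsPosDef (border A w a) := fun h =>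
        ha ((isPosDef_border_iff hassoc hR hN w a).1 h)
      rw [indicator_of_notMem (by simpa using ha), coneWeight_of_not_isPosDef _ _ hpd, mul_zero,
        mul_zero]
  have hmeasW : Measurable fun w : Fin m → 𝔄 =>
      ∫⁻ a : ℝ, coneWeight (((n : ℝ) - m) * algDim 𝔄 / 2 - 1) f (border A w a) :=
    ((measurable_coneWeight _ hf).comp hbA).lintegral_prod_right'
  have hcinner : ∀ y : Fin n → 𝔄, ‖(WithLp.toLp 2 y : PiLp 2 (fun _ : Fin n => 𝔄))‖ ^ 2 =
      colInner y y := by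
    intro y
    rw [colInner_eq_inner, real_inner_self_eq_norm_sq]
  have hRc : Continuous (starMul R) := LinearMap.continuous_of_finiteDimensional _
  have hcc : Continuous fun y : Fin n → 𝔄 => colInner y y := by
    unfold colInner
    fun_prop
  calc ∫⁻ y : Fin n → 𝔄, f (border A (starMul R y) (colInner y y))
      = c₁ * ∫⁻ z : PiLp 2 (fun _ : Fin n => 𝔄), f (border A (WithLp.ofLp (L z)) (‖z‖ ^ 2)) := by
        rw [hc₁ (fun y => f (border A (starMul R y) (colInner y y))) (hf.comp (hbA.comp (hRc.measurable.prodMk hcc.measurable)))]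
        congr 1
        refine lintegral_congr fun z => ?_
        rw [← hcinner]
        rfl
    _ = c₁ * (radialConst d * ∫⁻ w : PiLp 2 (fun _ : Fin m => 𝔄),
          ENNReal.ofReal (detPos A ^ (-(((n : ℝ) - m + 1) * algDim 𝔄 / 2 - 1))) *
          ∫⁻ a : ℝ, coneWeight (((n : ℝ) - m) * algDim 𝔄 / 2 - 1) f
            (border A (WithLp.ofLp w) a)) := by
        congr 1
        refine hmain.trans ?_
        rw [hdet, mul_assoc, ← lintegral_const_mul' _ _ ENNReal.ofReal_ne_top]
        congr 1
        refine lintegral_congr fun w => ?_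
        have hq : inner ℝ w (N' w) = colInner (WithLp.ofLp w) (N (WithLp.ofLp w)) :=
          (colInner_eq_inner _ _).symm
        rw [hq]
        exact hinner (WithLp.ofLp w)
    _ = _ := by
        rw [lintegral_const_mul' _ _ ENNReal.ofReal_ne_top, hc₂ _ hmeasW]
        ring

/-- The image of Lebesgue measure under `R ↦ R* R` is, up to a constant, the measure on the
positive definite matrices with density `|B| ^ ((n - m + 1) β / 2 - 1)`. -/
lemma exists_lintegral_starMulSelf {n m : ℕ} (hmn : m ≤ n)
    (hassoc : (∀ a b c : 𝔄, (a * b) * c = a * (b * c)) ∨ m ≤ 2) :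
    ∃ K : ENNReal, ∀ f : Matrix (Fin m) (Fin m) 𝔄 → ENNReal, Measurable f →
      ∫⁻ R, f (starMulSelf R) ∂(lebesgueMat 𝔄 n m) =
        K * ∫⁻ B, coneWeight (((n : ℝ) - m + 1) * algDim 𝔄 / 2 - 1) f B ∂(lebesgueHerm 𝔄 m) := by
  induction m with
  | zero =>
    refine ⟨1, fun f hf => ?_⟩
    have h1 : lebesgueMat 𝔄 n 0 univ = 1 :=
      (Measure.pi_univ _).trans (Finset.prod_eq_one fun i _ => by simp)
    have h2 : lebesgueHerm 𝔄 0 univ = 1 := by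
      rw [lebesgueHerm, Measure.map_apply measurable_hermOfCoords MeasurableSet.univ,
        preimage_univ, ← univ_prod_univ, Measure.prod_prod, volume_pi, Measure.pi_univ,
        Measure.pi_univ]
      simp
    have h3 : ∀ B : Matrix (Fin 0) (Fin 0) 𝔄,
        coneWeight (((n : ℝ) - (0 : ℕ) + 1) * algDim 𝔄 / 2 - 1) f B = f 0 := by
      intro B
      have hpd : IsPosDef B :=
        ⟨fun i => i.elim0, fun v hv => absurd (Subsingleton.elim v 0) hv⟩
      rw [coneWeight_of_isPosDef _ _ hpd, detPos,
        LinearMap.det_eq_one_of_subsingleton, Real.one_rpow, Real.one_rpow, ENNReal.ofReal_one,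
        _root_.one_mul, Subsingleton.elim B 0]
    have h4 : ∀ R : Matrix (Fin n) (Fin 0) 𝔄, f (starMulSelf R) = f 0 := fun R =>
      congrArg f (Subsingleton.elim _ _)
    simp_rw [h3, h4, lintegral_const, h1, h2, _root_.one_mul]
  | succ m ih =>
    obtain ⟨K, hK⟩ := ih (by omega) (hassoc.imp_right (by omega))
    have hassoc' : (∀ a b c : 𝔄, (a * b) * c = a * (b * c)) ∨ m ≤ 1 := hassoc.imp_right (by omega)
    obtain ⟨C, hC⟩ := exists_lintegral_last_column 𝔄 (show m < n by omega) hassoc'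
    refine ⟨K * C, fun f hf => ?_⟩
    set p := ((n : ℝ) - m + 1) * algDim 𝔄 / 2 - 1 with hp
    have hp' : ((n : ℝ) - (m + 1 : ℕ) + 1) * algDim 𝔄 / 2 - 1 = ((n : ℝ) - m) * algDim 𝔄 / 2 - 1 := by
      push_cast
      ring
    rw [hp']
    set p' := ((n : ℝ) - m) * algDim 𝔄 / 2 - 1
    -- The induction hypothesis, applied to the indicator of the complement of the cone, shows that
    -- degenerate Gram matrices form a null set; the last-column formula therefore applies almost
    -- everywhere.
    have hae : ∀ᵐ R ∂(lebesgueMat 𝔄 n m), IsPosDef (starMulSelf R) := by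
      have hmeas : Measurable ({B : Matrix (Fin m) (Fin m) 𝔄 | IsPosDef B}ᶜ.indicator
          (fun _ => (1 : ENNReal))) := measurable_const.indicator measurableSet_isPosDef.compl
      have h0 := hK _ hmeas
      have hz : ∀ B : Matrix (Fin m) (Fin m) 𝔄, coneWeight p ({B : Matrix (Fin m) (Fin m) 𝔄 |
          IsPosDef B}ᶜ.indicator (fun _ => (1 : ENNReal))) B = 0 := by
        intro B
        by_cases hB : IsPosDef B <;> simp [coneWeight, hB]
      simp_rw [hz] at h0
      rw [lintegral_zero, mul_zero,
        lintegral_eq_zero_iff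
          (f := fun R => {B : Matrix (Fin m) (Fin m) 𝔄 | IsPosDef B}ᶜ.indicator (fun _ => (1 : ENNReal))
            (starMulSelf R)) (hmeas.comp measurable_starMulSelf)] at h0
      filter_upwards [h0] with R hR
      by_contra hnot
      simp [hnot] at hR
    have hb : Measurable fun p : Matrix (Fin m) (Fin m) 𝔄 × (Fin m → 𝔄) × ℝ =>
      border p.1 p.2.1 p.2.2 := continuous_border.measurable
    have hcw : Measurable (coneWeight p' f) := measurable_coneWeight _ hf
    have hG₀ : Measurable fun A : Matrix (Fin m) (Fin m) 𝔄 =>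
        ∫⁻ w : Fin m → 𝔄, ∫⁻ a : ℝ, coneWeight p' f (border A w a) := by
      have h1 : Measurable fun q : Matrix (Fin m) (Fin m) 𝔄 × (Fin m → 𝔄) =>
          ∫⁻ a : ℝ, coneWeight p' f (border q.1 q.2 a) :=
        (hcw.comp (hb.comp (MeasurableEquiv.prodAssoc.measurable))).lintegral_prod_right'
      exact h1.lintegral_prod_right'
    let G : Matrix (Fin m) (Fin m) 𝔄 → ENNReal := fun A => ENNReal.ofReal (detPos A ^ (-p)) *
        ∫⁻ w : Fin m → 𝔄, ∫⁻ a : ℝ, coneWeight p' f (border A w a)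
    have hG : Measurable G := (measurable_detPos.pow_const _).ennreal_ofReal.mul hG₀
    -- The factor `|A|^(-p)` from the last column cancels the weight `|A|^p` of the induction
    -- hypothesis. Off the cone both sides vanish, since a positive definite bordered matrix has a
    -- positive definite leading block.
    have hGw : ∀ A, coneWeight p G A =
        ∫⁻ w : Fin m → 𝔄, ∫⁻ a : ℝ, coneWeight p' f (border A w a) := by
      intro A
      by_cases hA : IsPosDef A
      · have hdpos := detPos_pos hA
        rw [coneWeight_of_isPosDef _ _ hA]
        simp only [G]
        rw [← mul_assoc, ← ENNReal.ofReal_mul (by positivity), ← Real.rpow_add hdpos,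
          add_neg_cancel, Real.rpow_zero, ENNReal.ofReal_one, _root_.one_mul]
      · have hz : ∀ w a, coneWeight p' f (border A w a) = 0 := fun w a =>
          coneWeight_of_not_isPosDef _ _ (fun h => hA (IsPosDef.of_border h))
        simp_rw [hz]
        rw [coneWeight_of_not_isPosDef _ _ hA]
        simp
    calc ∫⁻ R, f (starMulSelf R) ∂(lebesgueMat 𝔄 n (m + 1))
        = ∫⁻ R, (∫⁻ y : Fin n → 𝔄, f (border (starMulSelf R) (starMul R y) (colInner y y)))
            ∂(lebesgueMat 𝔄 n m) := by
          rw [lintegral_lebesgueMat_succ (f := fun R => f (starMulSelf R)) (hf.comp measurable_starMulSelf)]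
          simp only [starMulSelf_snoc]
      _ = ∫⁻ R, C * G (starMulSelf R) ∂(lebesgueMat 𝔄 n m) :=
          lintegral_congr_ae (hae.mono fun R hR => hC f hf R hR)
      _ = C * (K * ∫⁻ B, coneWeight p G B ∂(lebesgueHerm 𝔄 m)) := by
          rw [lintegral_const_mul (f := fun R => G (starMulSelf R)) _ (hG.comp measurable_starMulSelf), hK G hG]
      _ = _ := by
          simp_rw [hGw]
          rw [lintegral_lebesgueHerm_succ hcw]
          ring

end Wishart

/-! ### The constant, and the image of densities -/

section Distributions

set_option linter.unusedSectionVars false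

variable {𝔄 : Type*} [NormedAddCommGroup 𝔄] [InnerProductSpace ℝ 𝔄] [FiniteDimensional ℝ 𝔄]
  [MeasurableSpace 𝔄] [BorelSpace 𝔄] [Mul 𝔄] [One 𝔄] [RealNormedDivisionAlgebra 𝔄]

lemma reTrace_starMulSelf {n m : ℕ} (R : Matrix (Fin n) (Fin m) 𝔄) :
    reTrace (starMulSelf R) = ∑ k, ∑ i, ‖R k i‖ ^ 2 := by
  rw [Finset.sum_comm]
  refine Finset.sum_congr rfl fun i _ => ?_
  simp only [starMulSelf, Matrix.of_apply, conj_mul_self, ← Finset.sum_smul, rePart_smul_one,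
    real_inner_self_eq_norm_sq]

lemma measurable_reTrace {m : ℕ} : Measurable (reTrace : Matrix (Fin m) (Fin m) 𝔄 → ℝ) := by
  refine Continuous.measurable ?_
  unfold reTrace rePart
  fun_prop

variable (𝔄) in
-- `Re tr R* R` is the sum of the squared norms of the entries, so the integral is a product of `mn`
-- Gaussian integrals over `𝔄`, each `π^(β/2)`.
lemma lintegral_exp_neg_reTrace (n m : ℕ) :
    ∫⁻ R, ENNReal.ofReal (Real.exp (-reTrace (starMulSelf R))) ∂(lebesgueMat 𝔄 n m) =
      ENNReal.ofReal (Real.pi ^ (m * n * algDim 𝔄 / 2)) := by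
  have h1 : ∀ R : Fin n → Fin m → 𝔄,
      Real.exp (-reTrace (starMulSelf (Matrix.of R))) =
        ∏ k, ∏ i, Real.exp (-1 * ‖R k i‖ ^ 2) := by
    intro R
    rw [reTrace_starMulSelf]
    simp_rw [Matrix.of_apply, ← Real.exp_sum, ← Finset.mul_sum, neg_one_mul]
  have h2 : ∫ R : Fin n → Fin m → 𝔄,
      Real.exp (-reTrace (starMulSelf (Matrix.of R))) =
        Real.pi ^ (m * n * algDim 𝔄 / 2) := by
    simp_rw [h1]
    rw [integral_fintype_prod_volume_eq_pow (E := Fin m → 𝔄)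
      (fun r => ∏ i, Real.exp (-1 * ‖r i‖ ^ 2)),
      integral_fintype_prod_volume_eq_pow (E := 𝔄) (fun x => Real.exp (-1 * ‖x‖ ^ 2)),
      GaussianFourier.integral_rexp_neg_mul_sq_norm one_pos, div_one, ← Real.rpow_natCast,
      ← Real.rpow_natCast, ← Real.rpow_mul Real.pi_pos.le, ← Real.rpow_mul Real.pi_pos.le]
    congr 1
    simp only [Fintype.card_fin, algDim]
    ring
  have hpos : 0 < Real.pi ^ (m * n * algDim 𝔄 / 2) := Real.rpow_pos_of_pos Real.pi_pos _
  -- A non-integrable function would have Bochner integral 0, contradicting the positive value just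
  -- computed.
  have h3 : Integrable fun R : Fin n → Fin m → 𝔄 =>
      Real.exp (-reTrace (starMulSelf (Matrix.of R))) := by
    by_contra h
    rw [integral_undef h] at h2
    exact hpos.ne h2
  rw [← h2, ofReal_integral_eq_lintegral_ofReal h3 (ae_of_all _ fun _ => (Real.exp_pos _).le)]
  rfl

/-- The image of Lebesgue measure under `R ↦ R* R`, with its constant. -/
lemma multiGamma_pos_and_lintegral_starMulSelf {n m : ℕ} (hmn : m ≤ n)
    (hassoc : (∀ a b c : 𝔄, (a * b) * c = a * (b * c)) ∨ m ≤ 2) :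
    0 < multiGamma 𝔄 m (n * algDim 𝔄 / 2) ∧
    ∀ f : Matrix (Fin m) (Fin m) 𝔄 → ENNReal, Measurable f →
      ∫⁻ R, f (starMulSelf R) ∂(lebesgueMat 𝔄 n m) =
        ENNReal.ofReal (Real.pi ^ (m * n * algDim 𝔄 / 2) / multiGamma 𝔄 m (n * algDim 𝔄 / 2)) *
          ∫⁻ B, coneWeight (((n : ℝ) - m + 1) * algDim 𝔄 / 2 - 1) f B ∂(lebesgueHerm 𝔄 m) := by
  obtain ⟨K, hK⟩ := exists_lintegral_starMulSelf hmn hassoc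
  set p := ((n : ℝ) - m + 1) * algDim 𝔄 / 2 - 1 with hp
  set c := Real.pi ^ (m * n * algDim 𝔄 / 2)
  have hc : 0 < c := Real.rpow_pos_of_pos Real.pi_pos _
  have hexp : Measurable fun B : Matrix (Fin m) (Fin m) 𝔄 =>
      ENNReal.ofReal (Real.exp (-reTrace B)) := measurable_reTrace.neg.exp.ennreal_ofReal
  -- For this test function the identity reads `c = K * I`, where `I` is the gamma integral. As `c`
  -- is positive and finite, `I` is positive and finite too, and `K = c / I`.
  have h := hK _ hexp
  rw [lintegral_exp_neg_reTrace] at h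
  set I := ∫⁻ B, coneWeight p (fun B : Matrix (Fin m) (Fin m) 𝔄 =>
      ENNReal.ofReal (Real.exp (-reTrace B))) B ∂(lebesgueHerm 𝔄 m) with hI
  have hcne : ENNReal.ofReal c ≠ 0 := (ENNReal.ofReal_pos.2 hc).ne'
  have hK0 : K ≠ 0 := by
    rintro rfl
    rw [zero_mul] at h
    exact hcne h
  have hI0 : I ≠ 0 := by
    intro h0
    rw [h0, mul_zero] at h
    exact hcne h
  have hItop : I ≠ ⊤ := by
    intro h0
    rw [h0, ENNReal.mul_top hK0] at h
    exact ENNReal.ofReal_ne_top h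
  have hGamma : multiGamma 𝔄 m (n * algDim 𝔄 / 2) = I.toReal := by
    have hexpo : n * algDim 𝔄 / 2 - ((m : ℝ) - 1) * algDim 𝔄 / 2 - 1 = p := by
      rw [hp]
      ring
    rw [multiGamma, hexpo, integral_eq_lintegral_of_nonneg_ae, hI,
      ← lintegral_indicator measurableSet_isPosDef]
    · congr 1
      refine lintegral_congr fun B => ?_
      by_cases hB : IsPosDef B
      · rw [coneWeight_of_isPosDef _ _ hB,
          indicator_of_mem (s := {B : Matrix (Fin m) (Fin m) 𝔄 | IsPosDef B}) hB,
          ENNReal.ofReal_mul (Real.exp_pos _).le, mul_comm]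
      · rw [coneWeight_of_not_isPosDef _ _ hB,
          indicator_of_notMem (s := {B : Matrix (Fin m) (Fin m) 𝔄 | IsPosDef B}) hB]
    · filter_upwards [ae_restrict_mem measurableSet_isPosDef] with B hB
      exact mul_nonneg (Real.exp_pos _).le (Real.rpow_nonneg (detPos_pos hB).le _)
    · exact (measurable_reTrace.neg.exp.mul (measurable_detPos.pow_const _)).aestronglyMeasurable
  have hGpos : 0 < I.toReal := ENNReal.toReal_pos hI0 hItop
  refine ⟨hGamma ▸ hGpos, fun f hf => ?_⟩
  rw [hK f hf, hGamma, ENNReal.ofReal_div_of_pos hGpos, ENNReal.ofReal_toReal hItop, h,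
    ENNReal.mul_div_cancel_right hI0 hItop]

/-- The image under `R ↦ R* R` of a distribution whose density is a function of `R* R`. -/
lemma map_starMulSelf_withDensity {n m : ℕ} (hmn : m ≤ n)
    (hassoc : (∀ a b c : 𝔄, (a * b) * c = a * (b * c)) ∨ m ≤ 2) (b : ℝ)
    {X : Matrix (Fin m) (Fin m) 𝔄 → ℝ} (hX : Measurable X) :
    ((lebesgueMat 𝔄 n m).withDensity ((starMulSelf ⁻¹' unitCone 𝔄 m).indicator fun R =>
        ENNReal.ofReal (multiGamma 𝔄 m (n * algDim 𝔄 / 2) /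
          (Real.pi ^ (m * n * algDim 𝔄 / 2) * b) * X (starMulSelf R)))).map starMulSelf =
      (lebesgueHerm 𝔄 m).withDensity ((unitCone 𝔄 m).indicator fun B =>
        ENNReal.ofReal (detPos B ^ (((n : ℝ) - m + 1) * algDim 𝔄 / 2 - 1) / b * X B)) := by
  obtain ⟨hGamma, hlaw⟩ := multiGamma_pos_and_lintegral_starMulSelf hmn hassoc
  set Γ := multiGamma 𝔄 m (n * algDim 𝔄 / 2)
  set c := Real.pi ^ (m * n * algDim 𝔄 / 2)
  set p := ((n : ℝ) - m + 1) * algDim 𝔄 / 2 - 1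
  have hc : 0 < c := Real.rpow_pos_of_pos Real.pi_pos _
  ext s hs
  let f : Matrix (Fin m) (Fin m) 𝔄 → ENNReal :=
    s.indicator ((unitCone 𝔄 m).indicator fun B => ENNReal.ofReal (Γ / (c * b) * X B))
  have hf : Measurable f :=
    ((hX.const_mul _).ennreal_ofReal.indicator measurableSet_unitCone).indicator hs
  rw [Measure.map_apply measurable_starMulSelf hs,
    withDensity_apply _ (measurable_starMulSelf hs), withDensity_apply _ hs,
    ← lintegral_indicator (measurable_starMulSelf hs), ← lintegral_indicator hs]
  refine (hlaw f hf).trans ?_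
  rw [← lintegral_const_mul' _ _ ENNReal.ofReal_ne_top]
  refine lintegral_congr fun B => ?_
  by_cases hBs : B ∈ s
  swap
  · rw [indicator_of_notMem hBs]
    by_cases hB : IsPosDef B
    · simp [coneWeight_of_isPosDef _ _ hB, f, hBs]
    · simp [coneWeight_of_not_isPosDef _ _ hB]
  rw [indicator_of_mem hBs]
  by_cases hBu : B ∈ unitCone 𝔄 m
  swap
  · rw [indicator_of_notMem hBu]
    by_cases hB : IsPosDef B
    · simp [coneWeight_of_isPosDef _ _ hB, f, hBu]
    · simp [coneWeight_of_not_isPosDef _ _ hB]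
  have hB : IsPosDef B := hBu.1
  have hdet : 0 ≤ detPos B ^ p := Real.rpow_nonneg (detPos_pos hB).le _
  rw [indicator_of_mem hBu, coneWeight_of_isPosDef _ _ hB]
  simp only [f]
  -- Only the factors pulled into `ENNReal.ofReal` from the left need to be nonnegative, so the
  -- signs of `b` and `X B` are irrelevant.
  rw [indicator_of_mem hBs, indicator_of_mem hBu, ← ENNReal.ofReal_mul hdet,
    ← ENNReal.ofReal_mul (by positivity)]
  congr 1
  -- A beta constant may be 0, for instance if its integral diverges; division by zero then makes
  -- both densities vanish.
  rcases eq_or_ne b 0 with rfl | hb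
  · simp
  · field_simp

end Distributions

end NormedDivision

theorem theorem3p2 {𝔄 : Type*} [NormedAddCommGroup 𝔄] [InnerProductSpace ℝ 𝔄]
    [FiniteDimensional ℝ 𝔄] [MeasurableSpace 𝔄] [BorelSpace 𝔄] [Mul 𝔄] [One 𝔄]
    [RealNormedDivisionAlgebra 𝔄] {m n : ℕ} (hm : 1 ≤ m) (hmn : m ≤ n)
    (hassoc : (∀ a b c : 𝔄, (a * b) * c = a * (b * c)) ∨ m ≤ 2)
    (ν : ℝ) (κ τ : Fin m → ℝ)
    {Ω : Type*} [MeasurableSpace Ω] (P : Measure Ω) [IsProbabilityMeasure P]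
    (R : Ω → Matrix (Fin n) (Fin m) 𝔄) :
    (HasLaw R (pearsonRieszI 𝔄 n ν κ τ) P →
      HasLaw (fun ω => starMulSelf (R ω)) (cBetaRieszI 𝔄 n ν κ τ) P) ∧
    (HasLaw R (pearsonRieszII 𝔄 n ν κ τ) P →
      HasLaw (fun ω => starMulSelf (R ω)) (kBetaRieszI 𝔄 n ν κ τ) P) := by
  have hsub : Measurable fun B : Matrix (Fin m) (Fin m) 𝔄 => 1 - B :=
    (continuous_const.sub continuous_id).measurable
  constructor
  · intro h
    -- It remains to identify the image of the explicit measure; here `b` is the beta constant and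
    -- `X` collects the factors depending on `R* R`.
    refine HasLaw.fun_comp (Y := starMulSelf) ⟨measurable_starMulSelf.aemeasurable, ?_⟩ h
    have hmap := map_starMulSelf_withDensity hmn hassoc
      (cBeta 𝔄 (ν * algDim 𝔄 / 2) κ (n * algDim 𝔄 / 2) τ)
      (((measurable_detPos.comp hsub).pow_const ((ν - m + 1) * algDim 𝔄 / 2 - 1)).mul
        (((measurable_highestWeight κ).comp hsub).mul (measurable_highestWeight τ)))
    simpa only [pearsonRieszI, cBetaRieszI, mul_assoc, Pi.mul_apply, Function.comp_apply] using hmap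
  · intro h
    refine HasLaw.fun_comp (Y := starMulSelf) ⟨measurable_starMulSelf.aemeasurable, ?_⟩ h
    have hmap := map_starMulSelf_withDensity hmn hassoc
      (kBeta 𝔄 (ν * algDim 𝔄 / 2) κ (n * algDim 𝔄 / 2) τ)
      (((measurable_detPos.comp hsub).pow_const ((ν - m + 1) * algDim 𝔄 / 2 - 1)).mul
        (((measurable_highestWeight κ).comp (measurable_matInv.comp hsub)).mul
          ((measurable_highestWeight τ).comp measurable_matInv)))
    simpa only [pearsonRieszII, kBetaRieszI, mul_assoc, Pi.mul_apply, Function.comp_apply] using hmap
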